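/- Let $\mathbb K$ be $\mathbb R$, $\mathbb C$ or $\mathbb H$, let $\delta=\dim_{\mathbb R}\mathbb K\in\{1,2,4\}$, and regard $\mathbb K^m$ as a right $\mathbb K$-linear space with $\|x\|=\left(\sum_i|\xi_i|^2\right)^{1/2}$ and unit sphere $\mathbf S(m,\mathbb K)$. For even $p\ge 2$ let $\Phi_{\mathbb K}(m,p)$ be the set of functions $\phi:\mathbb K^m\to\mathbb C$ that are homogeneous polynomials of degree $p$ on the real space $\mathbb R^{\delta m}\equiv\mathbb K^m$ and satisfy $\phi(x\alpha)=\phi(x)$ for all $x\in\mathbb K^m$ and all $\alpha\in\mathbb K$ with $|\alpha|=1$. A projective cubature formula of index $p$ with $n$ nodes on $\mathbf S(m,\mathbb K)$ consists of points $x_1,\dots,x_n\in\mathbf S(m,\mathbb K)$ such that $x_i\ne x_k\alpha$ whenever $i\neq k$ and $|\alpha|=1$, and of weights $\rho_1,\dots,\rho_n>0$ with $\sum_k\rho_k=1$, such that $$\int_{\mathbf S(m,\mathbb K)}\phi\,d\sigma=\sum_{k=1}^n\phi(x_k)\rho_k\qquad\text{for all }\phi\in\Phi_{\mathbb K}(m,p),$$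 where $\sigma$ is the normalized surface measure. Let $N_{\mathbb R}(m,p)$ be the least $n$ for which there is a linear isometric embedding of the real space $\ell_2^m$ into the real space $\ell_p^n$, and put $\nu_{\mathbb K}(p)=N_{\mathbb R}(\delta,2\lfloor p/4\rfloor)$. **Theorem.** Let $m\ge 2$ and let $p\ge 4$ be even. If there is a projective cubature formula of index $p$ with $n$ nodes on $\mathbf S(m-1,\mathbb K)$, then there is a projective cubature formula of index $p$ with $n'$ nodes on $\mathbf S(m,\mathbb K)$, where $$n'=\begin{cases}\nu_{\mathbb K}(p)\,(p/2+1)\,n, & p\equiv 2\pmod 4,\\ \nu_{\mathbb K}(p)\,\bigl((p/2)\,n+1\bigr), & p\equiv 0\pmod 4.\end{cases}$$ -/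

import Mathlib

open MeasureTheory Module
open scoped Quaternion ENNReal

noncomputable section

namespace ProjCubature

/-- The quaternions carry their Borel σ-algebra. -/
instance : MeasurableSpace ℍ := borel ℍ

instance : BorelSpace ℍ := ⟨rfl⟩

instance : SecondCountableTopology ℍ :=
  haveI : ProperSpace ℍ := FiniteDimensional.proper ℝ ℍ
  inferInstance

/-- `Vec K m` is `K^m` with the Euclidean norm `‖x‖ = (∑ |ξ_i|²)^(1/2)`. It is used below for
`K = ℝ, ℂ, ℍ`, and is in particular a real Euclidean space. -/
abbrev Vec (K : Type) (m : ℕ) : Type := PiLp 2 (fun _ : Fin m => K)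

section Field

variable (K : Type) [NormedDivisionRing K] [InnerProductSpace ℝ K] [FiniteDimensional ℝ K]

variable {K} in
/-- The right multiplication `x ↦ x α` of a column `x ∈ K^m` by a scalar `α ∈ K`. -/
def rmul {m : ℕ} (x : Vec K m) (α : K) : Vec K m := WithLp.toLp 2 fun i => x i * α

/-- `φ : V → ℂ` is a complex-valued homogeneous polynomial of degree `p` in the real coordinates
on the finite-dimensional real space `V`. (The choice of the real basis is immaterial.) -/
def IsHomogeneousPolynomial (V : Type) [AddCommGroup V] [Module ℝ V] [Module.Finite ℝ V]
    (p : ℕ) (φ : V → ℂ) : Prop :=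
  ∃ P : MvPolynomial (Fin (finrank ℝ V)) ℂ, P.IsHomogeneous p ∧
    ∀ x : V, φ x = MvPolynomial.eval (fun i => (((finBasis ℝ V).repr x i : ℝ) : ℂ)) P

/-- The class `Φ_K(m,p)`: the homogeneous polynomials of degree `p` on the real space underlying
`K^m` that are invariant under `x ↦ x α` for all `α ∈ K` with `|α| = 1`. -/
def Phi (m p : ℕ) : Set (Vec K m → ℂ) :=
  {φ | IsHomogeneousPolynomial (Vec K m) p φ ∧
    ∀ (x : Vec K m) (α : K), ‖α‖ = 1 → φ (rmul x α) = φ x}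

/-- The normalized surface measure on the unit sphere `S(m,K)` of `K^m`, induced by the
Euclidean volume. -/
def sphereMeasure [MeasurableSpace K] [BorelSpace K] [SecondCountableTopology K] (m : ℕ) :
    Measure (Metric.sphere (0 : Vec K m) 1) :=
  ((volume : Measure (Vec K m)).toSphere Set.univ)⁻¹ • (volume : Measure (Vec K m)).toSphere

/-- A projective cubature formula of index `p` with `n` nodes on `S(m,K)`: pairwise projectively
distinct nodes on the unit sphere and positive weights with sum `1` that integrate exactly
every function of the class `Φ_K(m,p)`. -/
structure ProjectiveCubature [MeasurableSpace K] [BorelSpace K] [SecondCountableTopology K]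
    (m p n : ℕ) where
  /-- the nodes, as representatives on the unit sphere -/
  node : Fin n → Vec K m
  /-- the weights -/
  weight : Fin n → ℝ
  norm_node : ∀ k, ‖node k‖ = 1
  node_distinct : ∀ i k, i ≠ k → ∀ α : K, ‖α‖ = 1 → node i ≠ rmul (node k) α
  weight_pos : ∀ k, 0 < weight k
  sum_weight : ∑ k, weight k = 1
  integral_eq : ∀ φ ∈ Phi K m p,
    ∫ x : Metric.sphere (0 : Vec K m) 1, φ x ∂(sphereMeasure K m)
      = ∑ k, φ (node k) * (weight k : ℂ)

/-- There is a linear isometric embedding of the real `ℓ_2^m` into the real `ℓ_p^n`. -/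
def HasIsometricEmbedding (m p n : ℕ) : Prop :=
  ∃ T : PiLp 2 (fun _ : Fin m => ℝ) →ₗ[ℝ] PiLp (p : ℝ≥0∞) (fun _ : Fin n => ℝ),
    ∀ y, ‖T y‖ = ‖y‖

/-- `N_ℝ(m,p)`: the least `n` such that the real `ℓ_2^m` embeds isometrically into `ℓ_p^n`. -/
def minReal (m p : ℕ) : ℕ := sInf {n | HasIsometricEmbedding m p n}

/-- `ν_K(p) = N_ℝ(δ, 2⌊p/4⌋)`, where `δ` is the real dimension of `K`. -/
def nu (p : ℕ) : ℕ := minReal (finrank ℝ K) (2 * (p / 4))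

end Field

end ProjCubature

end

/-! Write a point of `K^(m+1)` as `(ξ, y)` with `ξ` in `K` and `y` in `K^m`. The weight `exp
(-‖x‖²)` factors over this splitting, and for homogeneous functions a Gaussian integral is a
constant times the mean over the sphere. An invariant `φ` is a sum of components of bidegree `(j, p
- j)`, each invariant under a common right multiplication of `ξ` and `y`. Components with odd `j`
integrate to zero.

For even `j` the integral over `ξ` is replaced by a sum over `ν` points `u l`, the normalized
vectors of a minimal isometric embedding. These are exact only for even degrees up to `2⌊p/4⌋`, but
that suffices: if `j` is larger, invariance moves `ξ` to `1` and `y` to `y ξ⁻¹`. Since `ξ⁻¹` is the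
conjugate of `ξ` on the unit sphere, the component becomes a polynomial in `ξ` of degree `p - j ≤
2⌊p/4⌋` (`InvariantDecomposition.integral_comp`). The resulting function of `y` is invariant, so the
given formula with nodes `y k` integrates it. Only the radial moments `M j` remain
(`exists_integral_eq_sum_radialMoment`).

With `p = 2q`, these moments are positive definite (`posDefUpTo_radialMoment`), so Gauss quadrature
in the slope `‖ξ‖/‖y‖`, taken with both signs, gives `q + 1` nonzero nodes (`exists_quadrature`). If
`q` is even, `q` nonzero nodes and a mass at infinity also suffice (`exists_quadrature_infty`).
Infinite slope is the single projective point `(1, 0)`, shared by all pairs `(l, k)`. To reach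
exactly `ν (q n + 1)` nodes, `ν - 1` of the `ν n` pairs use the `(q + 1)`-node rule, the others the
rule with infinity, and the shared point adds one (`exists_cubature_succ`). -/

noncomputable section

namespace ProjCubature

/-! ### Homogeneous polynomial functions without coordinates -/

section HomPoly

variable {V W : Type} [AddCommGroup V] [Module ℝ V] [AddCommGroup W] [Module ℝ W]

variable (V) in
/-- The complex-valued homogeneous polynomial functions of degree `k` on a real vector space,
as the span of the products of `k` real linear forms. -/
def homPoly (k : ℕ) : Submodule ℂ (V → ℂ) :=
  Submodule.span ℂ (Set.range fun (ℓ : Fin k → Dual ℝ V) (x : V) => ∏ i, (ℓ i x : ℂ))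

lemma prod_forms_mem_homPoly {k : ℕ} (ℓ : Fin k → Dual ℝ V) :
    (fun x => ∏ i, (ℓ i x : ℂ)) ∈ homPoly V k :=
  Submodule.subset_span ⟨ℓ, rfl⟩

lemma form_pow_mem_homPoly (ℓ : Dual ℝ V) (k : ℕ) :
    (fun x => (ℓ x : ℂ) ^ k) ∈ homPoly V k := by
  simpa using prod_forms_mem_homPoly (fun _ : Fin k => ℓ)

lemma one_mem_homPoly : (1 : V → ℂ) ∈ homPoly V 0 := by
  convert prod_forms_mem_homPoly (fun _ : Fin 0 => (0 : Dual ℝ V)) using 1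
  ext x
  simp

lemma mul_mem_homPoly {k l : ℕ} {f g : V → ℂ} (hf : f ∈ homPoly V k) (hg : g ∈ homPoly V l) :
    f * g ∈ homPoly V (k + l) := by
  induction hf, hg using Submodule.span_induction₂ with
  | mem_mem f g hf hg =>
    obtain ⟨a, rfl⟩ := hf
    obtain ⟨b, rfl⟩ := hg
    have := prod_forms_mem_homPoly (Fin.append a b)
    simp only [Fin.prod_univ_add, Fin.append_left, Fin.append_right] at this
    exact this
  | zero_left => simp
  | zero_right => simp
  | add_left f g h _ _ _ h1 h2 => rw [add_mul]; exact add_mem h1 h2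
  | add_right f g h _ _ _ h1 h2 => rw [mul_add]; exact add_mem h1 h2
  | smul_left r f g _ _ h => rw [smul_mul_assoc]; exact Submodule.smul_mem _ _ h
  | smul_right r f g _ _ h => rw [mul_smul_comm]; exact Submodule.smul_mem _ _ h

lemma prod_mem_homPoly {ι : Type} (s : Finset ι) (d : ι → ℕ) (f : ι → V → ℂ)
    (h : ∀ i ∈ s, f i ∈ homPoly V (d i)) : ∏ i ∈ s, f i ∈ homPoly V (∑ i ∈ s, d i) := by
  classical
  induction s using Finset.induction_on with
  | empty => simpa using one_mem_homPoly
  | insert a s ha ih =>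
    rw [Finset.prod_insert ha, Finset.sum_insert ha]
    exact mul_mem_homPoly (h a (by simp)) (ih fun i hi => h i (by simp [hi]))

lemma comp_mem_homPoly {k : ℕ} {f : W → ℂ} (hf : f ∈ homPoly W k) (T : V →ₗ[ℝ] W) :
    (fun x => f (T x)) ∈ homPoly V k := by
  induction hf using Submodule.span_induction with
  | mem f hf =>
    obtain ⟨a, rfl⟩ := hf
    exact prod_forms_mem_homPoly fun i => (a i).comp T
  | zero => exact zero_mem _
  | add f g _ _ h1 h2 => exact add_mem h1 h2
  | smul r f _ h => exact Submodule.smul_mem _ r h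

lemma homPoly_map_smul {k : ℕ} {f : V → ℂ} (hf : f ∈ homPoly V k) (t : ℝ) (x : V) :
    f (t • x) = (t : ℂ) ^ k * f x := by
  induction hf using Submodule.span_induction with
  | mem f hf =>
    obtain ⟨a, rfl⟩ := hf
    simp [Finset.prod_mul_distrib]
  | zero => simp
  | add f g _ _ h1 h2 => simp [h1, h2, mul_add]
  | smul r f _ h => simp only [Pi.smul_apply, smul_eq_mul, h]; ring

/-- The coefficients of a vector-valued polynomial in a real variable lie in every subspace that
contains its values. -/
lemma mem_of_forall_sum_pow_smul_mem {M : Type} [AddCommGroup M] [Module ℂ M] (S : Submodule ℂ M)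
    (n : ℕ) (v : ℕ → M) (h : ∀ t : ℝ, ∑ k ∈ Finset.range n, (t : ℂ) ^ k • v k ∈ S)
    {k : ℕ} (hk : k < n) : v k ∈ S := by
  rw [← Submodule.Quotient.mk_eq_zero, ← forall_dual_apply_eq_zero_iff ℂ]
  intro φ
  set P : Polynomial ℂ := ∑ k ∈ Finset.range n,
    Polynomial.monomial k (φ (Submodule.Quotient.mk (v k))) with hP
  have h0 : P = 0 := by
    apply Polynomial.eq_zero_of_infinite_isRoot
    apply (Set.infinite_range_of_injective Complex.ofReal_injective).mono
    rintro _ ⟨t, rfl⟩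
    have h1 := congrArg φ ((Submodule.Quotient.mk_eq_zero S).2 (h t))
    rw [← Submodule.mkQ_apply] at h1
    simp only [map_sum, map_smul, map_zero, Submodule.mkQ_apply, smul_eq_mul] at h1
    simp only [Set.mem_ofPred_eq, Polynomial.IsRoot.def, hP, Polynomial.eval_finsetSum,
      Polynomial.eval_monomial]
    rw [← h1]
    exact Finset.sum_congr rfl fun _ _ => mul_comm _ _
  have h2 := congrArg (fun Q => Polynomial.coeff Q k) h0
  simpa [hP, Polynomial.finsetSum_coeff, Polynomial.coeff_monomial, hk] using h2

/-- Polarization: the powers of the linear forms span the homogeneous polynomial functions. -/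
lemma homPoly_eq_span_pow (k : ℕ) :
    homPoly V k = Submodule.span ℂ (Set.range fun (ℓ : Dual ℝ V) (x : V) => (ℓ x : ℂ) ^ k) := by
  apply le_antisymm
  · apply Submodule.span_le.2
    rintro _ ⟨a, rfl⟩
    induction k with
    | zero => exact Submodule.subset_span ⟨0, by simp⟩
    | succ k ih =>
      simp only [Fin.prod_univ_succ]
      have key : ∀ g ∈ Submodule.span ℂ (Set.range fun (ℓ : Dual ℝ V) (x : V) => (ℓ x : ℂ) ^ k),
          (fun x => (a 0 x : ℂ) * g x) ∈
          Submodule.span ℂ (Set.range fun (ℓ : Dual ℝ V) (x : V) => (ℓ x : ℂ) ^ (k + 1)) := by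
        intro g hg
        induction hg using Submodule.span_induction with
        | mem g hg =>
          obtain ⟨b, rfl⟩ := hg
          -- The product `a 0 * b ^ k` is, up to the factor `k + 1`, the coefficient of `t` in `(t •
          -- a 0 + b) ^ (k + 1)`.
          have h1 := mem_of_forall_sum_pow_smul_mem
            (Submodule.span ℂ (Set.range fun (ℓ : Dual ℝ V) (x : V) => (ℓ x : ℂ) ^ (k + 1)))
            (k + 2) (fun j x => (a 0 x : ℂ) ^ j * (b x : ℂ) ^ (k + 1 - j) * ((k + 1).choose j : ℂ))
            (by
              intro t
              refine Submodule.subset_span ⟨t • a 0 + b, ?_⟩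
              ext x
              simp only [LinearMap.add_apply, LinearMap.smul_apply, smul_eq_mul,
                Complex.ofReal_add, Complex.ofReal_mul, add_pow, Finset.sum_apply, Pi.smul_apply]
              exact Finset.sum_congr rfl fun j _ => by ring)
            (k := 1) (by omega)
          have h2 := Submodule.smul_mem _ ((k + 1 : ℂ)⁻¹) h1
          convert h2 using 1
          ext x
          have : (k + 1 : ℂ) ≠ 0 := by exact_mod_cast Nat.succ_ne_zero k
          simp
          field_simp
        | zero =>
          have h0 : (fun x => (a 0 x : ℂ) * (0 : V → ℂ) x) = 0 := by ext x; simp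
          rw [h0]
          exact zero_mem _
        | add f g _ _ h1 h2 =>
          convert add_mem h1 h2 using 1
          ext x
          simp [mul_add]
        | smul r f _ h =>
          convert Submodule.smul_mem _ r h using 1
          ext x
          simp only [Pi.smul_apply, smul_eq_mul]; ring
      exact key _ (ih _)
  · apply Submodule.span_le.2
    rintro _ ⟨ℓ, rfl⟩
    exact form_pow_mem_homPoly ℓ k

/-- A homogeneous polynomial function on `V × W` is a sum of bihomogeneous ones. -/
lemma exists_bihomogeneous {k : ℕ} {f : V × W → ℂ} (hf : f ∈ homPoly (V × W) k) :
    ∃ F : ℕ → V → W → ℂ, (∀ x y, f (x, y) = ∑ j ∈ Finset.range (k + 1), F j x y) ∧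
      (∀ j y, (fun x => F j x y) ∈ homPoly V j) ∧
      (∀ j ≤ k, ∀ x, F j x ∈ homPoly W (k - j)) := by
  rw [homPoly_eq_span_pow] at hf
  induction hf using Submodule.span_induction with
  | mem f hf =>
    obtain ⟨a, rfl⟩ := hf
    refine ⟨fun j x y => (a (x, 0) : ℂ) ^ j * (a (0, y) : ℂ) ^ (k - j) * (k.choose j : ℂ),
      fun x y => ?_, fun j y => ?_, fun j _ x => ?_⟩
    · have : a (x, y) = a (x, 0) + a (0, y) := by rw [← map_add]; simp
      simp only [this, Complex.ofReal_add, add_pow]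
    · convert Submodule.smul_mem _ ((a (0, y) : ℂ) ^ (k - j) * (k.choose j : ℂ))
        (form_pow_mem_homPoly (a.comp (LinearMap.inl ℝ V W)) j) using 1
      ext x
      simp; ring
    · convert Submodule.smul_mem _ ((a (x, 0) : ℂ) ^ j * (k.choose j : ℂ))
        (form_pow_mem_homPoly (a.comp (LinearMap.inr ℝ V W)) (k - j)) using 1
      ext x
      simp; ring
  | zero => exact ⟨fun _ _ _ => 0, by simp, fun _ _ => zero_mem _, fun _ _ _ => zero_mem _⟩
  | add f g _ _ h1 h2 =>
    obtain ⟨F, hF, hF1, hF2⟩ := h1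
    obtain ⟨G, hG, hG1, hG2⟩ := h2
    exact ⟨fun j x y => F j x y + G j x y, fun x y => by simp [hF, hG, Finset.sum_add_distrib],
      fun j y => add_mem (hF1 j y) (hG1 j y), fun j hj x => add_mem (hF2 j hj x) (hG2 j hj x)⟩
  | smul r f _ h =>
    obtain ⟨F, hF, hF1, hF2⟩ := h
    exact ⟨fun j x y => r * F j x y, fun x y => by simp [hF, Finset.mul_sum],
      fun j y => Submodule.smul_mem _ r (hF1 j y),
      fun j hj x => Submodule.smul_mem _ r (hF2 j hj x)⟩

/-- Bridges the coordinate definition to `homPoly`, whose span form allows induction on products of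
linear forms and composition with linear maps. -/
lemma isHomogeneousPolynomial_iff_mem_homPoly [Module.Finite ℝ V] {k : ℕ} {φ : V → ℂ} :
    IsHomogeneousPolynomial V k φ ↔ φ ∈ homPoly V k := by
  constructor
  · rintro ⟨P, hP, h⟩
    have hφ : φ = ∑ d ∈ P.support, P.coeff d •
        ∏ i, fun x : V => (((finBasis ℝ V).repr x i : ℝ) : ℂ) ^ d i := by
      ext x
      rw [h, MvPolynomial.eval_eq']
      simp
    rw [hφ]
    refine Submodule.sum_mem _ fun d hd => Submodule.smul_mem _ _ ?_
    have h1 := prod_mem_homPoly Finset.univ (fun i => d i)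
      (fun i (x : V) => (((finBasis ℝ V).repr x i : ℝ) : ℂ) ^ d i)
      fun i _ => form_pow_mem_homPoly ((finBasis ℝ V).coord i) (d i)
    have h2 : ∑ i, d i = k := by
      rw [← hP (MvPolynomial.mem_support_iff.1 hd), Finsupp.weight_apply,
        Finsupp.sum_fintype _ _ (by simp)]
      simp
    rwa [h2] at h1
  · intro hφ
    induction hφ using Submodule.span_induction with
    | mem f hf =>
      obtain ⟨a, rfl⟩ := hf
      refine ⟨∏ i, ∑ t, MvPolynomial.C (a i (finBasis ℝ V t) : ℂ) * MvPolynomial.X t, ?_, ?_⟩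
      · simpa using MvPolynomial.IsHomogeneous.prod Finset.univ _ (fun _ : Fin k => 1) fun i _ =>
          MvPolynomial.IsHomogeneous.sum _ _ _ fun t _ =>
            MvPolynomial.isHomogeneous_C_mul_X (a i (finBasis ℝ V t) : ℂ) t
      · intro x
        simp only [map_prod, map_sum, map_mul, MvPolynomial.eval_C, MvPolynomial.eval_X]
        refine Finset.prod_congr rfl fun i _ => ?_
        conv_lhs => rw [← (finBasis ℝ V).sum_repr x, map_sum, Complex.ofReal_sum]
        exact Finset.sum_congr rfl fun t _ => by
          rw [map_smul, smul_eq_mul, Complex.ofReal_mul, mul_comm]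
    | zero => exact ⟨0, MvPolynomial.isHomogeneous_zero _ _ _, by simp⟩
    | add f g _ _ h1 h2 =>
      obtain ⟨P, hP, h⟩ := h1
      obtain ⟨Q, hQ, h'⟩ := h2
      exact ⟨P + Q, hP.add hQ, fun x => by simp [h, h']⟩
    | smul r f _ h =>
      obtain ⟨P, hP, h⟩ := h
      exact ⟨MvPolynomial.C r * P, by simpa using (MvPolynomial.isHomogeneous_C _ r).mul hP,
        fun x => by simp [h]⟩

end HomPoly

/-! ### Continuity and even powers of the norm -/

section HomPolyNormed

variable {E : Type} [NormedAddCommGroup E] [InnerProductSpace ℝ E] [FiniteDimensional ℝ E]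

lemma continuous_of_mem_homPoly {E : Type} [NormedAddCommGroup E] [NormedSpace ℝ E]
    [FiniteDimensional ℝ E] {k : ℕ} {f : E → ℂ} (hf : f ∈ homPoly E k) : Continuous f := by
  induction hf using Submodule.span_induction with
  | mem f hf =>
    obtain ⟨a, rfl⟩ := hf
    have hc : ∀ i, Continuous (a i) := fun i => LinearMap.continuous_of_finiteDimensional (a i)
    fun_prop
  | zero => exact continuous_zero
  | add f g _ _ h1 h2 => exact h1.add h2
  | smul r f _ h => exact h.const_smul r

/-- Multiplying by these powers raises the degree by an even amount without changing values on the
unit sphere, so exactness in degree `p` descends to lower degrees of the same parity. -/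
lemma norm_pow_mem_homPoly {j : ℕ} (hj : Even j) :
    (fun x : E => ((‖x‖ ^ j : ℝ) : ℂ)) ∈ homPoly E j := by
  have h2 : (fun x : E => ((‖x‖ ^ 2 : ℝ) : ℂ)) ∈ homPoly E 2 := by
    have : (fun x : E => ((‖x‖ ^ 2 : ℝ) : ℂ)) = ∑ i : Fin (finrank ℝ E), fun x : E =>
        (((innerₛₗ ℝ (stdOrthonormalBasis ℝ E i)) x : ℝ) : ℂ) ^ 2 := by
      ext x
      rw [← (stdOrthonormalBasis ℝ E).sum_sq_norm_inner_right x]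
      simp
    rw [this]
    exact Submodule.sum_mem _ fun i _ => form_pow_mem_homPoly _ 2
  obtain ⟨k, rfl⟩ := hj
  have := prod_mem_homPoly (Finset.range k) (fun _ => 2) (fun _ => _) fun i _ => h2
  rw [Finset.prod_const, Finset.sum_const, Finset.card_range, smul_eq_mul, mul_two] at this
  convert this using 1
  ext x
  simp only [Pi.pow_apply, Complex.ofReal_pow]
  ring

end HomPolyNormed

/-! ### Orthogonal polynomials and Gauss quadrature -/

section Gauss

open Polynomial

/-- A linear functional on real polynomials is positive definite up to degree `d` if it is
positive on the squares of nonzero polynomials of degree at most `d`. -/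
def PosDefUpTo (L : ℝ[X] →ₗ[ℝ] ℝ) (d : ℕ) : Prop :=
  ∀ f : ℝ[X], f ≠ 0 → f.natDegree ≤ d → 0 < L (f * f)

/-- `P` is orthogonal for `L` to all polynomials of degree at most `d`. -/
def OrthUpTo (L : ℝ[X] →ₗ[ℝ] ℝ) (d : ℕ) (P : ℝ[X]) : Prop :=
  ∀ g : ℝ[X], g.natDegree ≤ d → L (P * g) = 0

variable {L : ℝ[X] →ₗ[ℝ] ℝ} {d : ℕ}

lemma PosDefUpTo.mono {e : ℕ} (hL : PosDefUpTo L d) (h : e ≤ d) : PosDefUpTo L e :=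
  fun f hf hd => hL f hf (hd.trans h)

/-- Positive definiteness makes the form `L (f * g)` nondegenerate in degrees at most `d`, so `X ^
(d + 1)` has an orthogonal projection there; subtracting it gives `P`. -/
lemma exists_orthogonal (hL : PosDefUpTo L d) :
    ∃ P : ℝ[X], P.Monic ∧ P.natDegree = d + 1 ∧ OrthUpTo L d P := by
  let W := degreeLT ℝ (d + 1)
  have hW : ∀ {f : ℝ[X]}, f ∈ W ↔ f.natDegree ≤ d := by
    intro f
    rw [mem_degreeLT, degree_lt_iff_coeff_zero, natDegree_le_iff_coeff_eq_zero]
    rfl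
  have : FiniteDimensional ℝ W := Module.Finite.equiv (degreeLTEquiv ℝ (d + 1)).symm
  let B : W →ₗ[ℝ] Dual ℝ W :=
    LinearMap.mk₂ ℝ (fun f g => L ((f : ℝ[X]) * g)) (by simp [add_mul]) (by simp)
      (by simp [mul_add]) (by simp)
  have hB : Function.Injective B := by
    rw [injective_iff_map_eq_zero]
    intro f hf
    by_contra h0
    have h1 := hL f (by simpa using h0) (hW.1 f.2)
    have h2 : B f f = 0 := by rw [hf]; rfl
    exact h1.ne' h2
  have hS : Function.Surjective B :=
    (LinearMap.injective_iff_surjective_of_finrank_eq_finrank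
      (Subspace.dual_finrank_eq (K := ℝ) (V := W)).symm).1 hB
  obtain ⟨f, hf⟩ := hS ((L.comp (LinearMap.mulLeft ℝ (X ^ (d + 1)))).comp W.subtype)
  have hfd : (f : ℝ[X]).degree < ((d + 1 : ℕ) : WithBot ℕ) := mem_degreeLT.1 f.2
  refine ⟨X ^ (d + 1) - (f : ℝ[X]), monic_X_pow_sub hfd, ?_, fun g hg => ?_⟩
  · apply natDegree_eq_of_degree_eq_some
    rw [degree_sub_eq_left_of_degree_lt (by rwa [degree_X_pow]), degree_X_pow]
  · have := congrArg (fun φ => φ ⟨g, hW.2 hg⟩) hf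
    simp only [B, LinearMap.mk₂_apply, LinearMap.comp_apply, LinearMap.mulLeft_apply,
      Submodule.subtype_apply] at this
    rw [sub_mul, map_sub, this, sub_self]

/-- An orthogonal polynomial does not have a factor which is a sum of squares. -/
lemma not_sumSq_dvd (hL : PosDefUpTo L d) {P : ℝ[X]} (hP : P ≠ 0) (hPd : P.natDegree = d + 1)
    (hPo : OrthUpTo L d P) (a b : ℝ) : ¬ ((X - C a) ^ 2 + C (b ^ 2) ∣ P) := by
  rintro ⟨g, rfl⟩
  have hg : g ≠ 0 := right_ne_zero_of_mul hP
  have hQ : ((X - C a) ^ 2 + C (b ^ 2)).natDegree = 2 := by compute_degree!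
  rw [natDegree_mul (left_ne_zero_of_mul hP) hg, hQ] at hPd
  have h1 := hPo g (by omega)
  -- Orthogonality makes the left side zero, while the right side is a sum of two squares, the first
  -- of a nonzero polynomial of degree at most `d`.
  have h2 : L (((X - C a) ^ 2 + C (b ^ 2)) * g * g) =
      L (((X - C a) * g) * ((X - C a) * g)) + L ((C b * g) * (C b * g)) := by
    rw [← map_add]; congr 1; rw [C_pow]; ring
  have h3 : 0 < L (((X - C a) * g) * ((X - C a) * g)) := by
    refine hL _ (mul_ne_zero (X_sub_C_ne_zero a) hg) ?_
    rw [natDegree_mul (X_sub_C_ne_zero a) hg, natDegree_X_sub_C]; omega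
  have h4 : 0 ≤ L ((C b * g) * (C b * g)) := by
    by_cases hb : b = 0
    · simp [hb]
    · refine (hL _ (mul_ne_zero (by simpa using hb) hg) ?_).le
      rw [natDegree_mul (by simpa using hb) hg, natDegree_C]; omega
  linarith

/-- A nonreal root `a + b i` or a multiple real root `a` (with `b = 0`) would give a factor `(X -
a)² + b²`, excluded by `not_sumSq_dvd`. -/
lemma exists_roots (hL : PosDefUpTo L d) {P : ℝ[X]} (hP : P.Monic) (hPd : P.natDegree = d + 1)
    (hPo : OrthUpTo L d P) :
    ∃ z : Fin (d + 1) → ℝ, Function.Injective z ∧ ∀ i, P.eval (z i) = 0 := by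
  have hs : P.Splits := by
    refine Splits.of_splits_map (algebraMap ℝ ℂ) (IsAlgClosed.splits _) fun c hc => ?_
    have hc0 : aeval c P = 0 := by
      rw [← eval_map_algebraMap]
      exact (mem_roots'.1 hc).2
    by_contra him
    have hci : c.im ≠ 0 := fun h => him ⟨c.re, Complex.ext (by simp) (by simp [h])⟩
    apply not_sumSq_dvd hL hP.ne_zero hPd hPo c.re c.im
    convert quadratic_dvd_of_aeval_eq_zero_im_ne_zero P hc0 hci using 1
    rw [Complex.sq_norm, Complex.normSq_apply]
    simp only [map_mul, map_add, map_pow, map_ofNat]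
    ring
  have hnd : P.roots.Nodup := by
    rw [Multiset.nodup_iff_count_le_one]
    intro a
    rw [count_roots]
    by_contra! h
    apply not_sumSq_dvd hL hP.ne_zero hPd hPo a 0
    simpa using (le_rootMultiplicity_iff hP.ne_zero).1 h
  have hc : P.roots.toFinset.card = d + 1 := by
    rw [Multiset.toFinset_card_of_nodup hnd, ← hs.natDegree_eq_card_roots, hPd]
  refine ⟨P.roots.toFinset.orderEmbOfFin hc, (P.roots.toFinset.orderEmbOfFin hc).injective,
    fun i => ?_⟩
  have := P.roots.toFinset.orderEmbOfFin_mem hc i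
  rw [Multiset.mem_toFinset] at this
  exact (mem_roots'.1 this).2

/-- Gauss quadrature from the orthogonal polynomial. -/
lemma exists_gauss (hL : PosDefUpTo L d) {P : ℝ[X]} (hP : P.Monic) (hPd : P.natDegree = d + 1)
    (hPo : OrthUpTo L d P) :
    ∃ z w : Fin (d + 1) → ℝ, Function.Injective z ∧ (∀ i, P.eval (z i) = 0) ∧ (∀ i, 0 < w i) ∧
      ∀ f : ℝ[X], f.natDegree ≤ 2 * d + 1 → L f = ∑ i, w i * f.eval (z i) := by
  obtain ⟨z, hz, hroot⟩ := exists_roots hL hP hPd hPo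
  set ℓ := fun i => Lagrange.basis Finset.univ z i with hℓ
  have hex : ∀ f : ℝ[X], f.natDegree ≤ 2 * d + 1 → L f = ∑ i, L (ℓ i) * f.eval (z i) := by
    intro f hf
    have hlow : ∀ g : ℝ[X], g.degree < ((d + 1 : ℕ) : WithBot ℕ) →
        L g = ∑ i, L (ℓ i) * g.eval (z i) := by
      intro g hg
      conv_lhs => rw [Lagrange.eq_interpolate (s := Finset.univ) (v := z) hz.injOn
        (f := g) (by simpa using hg)]
      simp only [Lagrange.interpolate_apply, ← smul_eq_C_mul, map_sum, map_smul, smul_eq_mul]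
      exact Finset.sum_congr rfl fun i _ => mul_comm _ _
    have hdeg : (f %ₘ P).degree < ((d + 1 : ℕ) : WithBot ℕ) := by
      rw [← hPd, ← degree_eq_natDegree hP.ne_zero]
      exact degree_modByMonic_lt f hP
    have hdiv : (f /ₘ P).natDegree ≤ d := by
      rw [natDegree_divByMonic f hP]; omega
    conv_lhs => rw [← modByMonic_add_div f P, map_add, hPo _ hdiv, add_zero, hlow _ hdeg]
    refine Finset.sum_congr rfl fun i _ => ?_
    congr 1
    conv_rhs => rw [← modByMonic_add_div f P, eval_add, eval_mul, hroot i, zero_mul, add_zero]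
  refine ⟨z, fun i => L (ℓ i), hz, hroot, fun i => ?_, hex⟩
  have hne : ℓ i ≠ 0 := Lagrange.basis_ne_zero hz.injOn (Finset.mem_univ i)
  have hnd : (ℓ i).natDegree ≤ d := by
    have := Lagrange.degree_basis (s := Finset.univ) (v := z) hz.injOn (Finset.mem_univ i)
    exact (natDegree_eq_of_degree_eq_some (by simpa using this)).le
  -- The rule is exact for the square of the Lagrange polynomial `ℓ i`, which is `1` at `z i` and
  -- `0` at the other nodes; the weight is therefore `L (ℓ i * ℓ i) > 0`.
  have h1 := hL _ hne hnd
  rw [hex _ (natDegree_mul_le.trans (by omega))] at h1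
  rw [Finset.sum_eq_single i] at h1
  · simpa [hℓ, Lagrange.eval_basis_self hz.injOn (Finset.mem_univ i)] using h1
  · intro j _ hj
    simp [hℓ, Lagrange.eval_basis_of_ne hj.symm (Finset.mem_univ j)]
  · simp

/-- The functional `f ↦ ∑ f_j M_j` with moments `M`. -/
def momentFunctional (M : ℕ → ℝ) : ℝ[X] →ₗ[ℝ] ℝ := (basisMonomials ℝ).constr ℝ M

lemma momentFunctional_monomial (M : ℕ → ℝ) (j : ℕ) (a : ℝ) :
    momentFunctional M (monomial j a) = a * M j := by
  have h := (basisMonomials ℝ).constr_basis ℝ M j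
  rw [coe_basisMonomials] at h
  rw [← mul_one a, ← smul_eq_mul, ← smul_monomial, map_smul, momentFunctional, h]
  simp

lemma momentFunctional_eq_sum (M : ℕ → ℝ) {f : ℝ[X]} {k : ℕ} (hf : f.natDegree < k) :
    momentFunctional M f = ∑ j ∈ Finset.range k, f.coeff j * M j := by
  conv_lhs => rw [f.as_sum_range' k hf, map_sum]
  simp only [momentFunctional_monomial]

lemma momentFunctional_congr {M M' : ℕ → ℝ} {f : ℝ[X]} {k : ℕ} (hf : f.natDegree < k)
    (h : ∀ j < k, M j = M' j) : momentFunctional M f = momentFunctional M' f := by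
  rw [momentFunctional_eq_sum M hf, momentFunctional_eq_sum M' hf]
  exact Finset.sum_congr rfl fun j hj => by rw [h j (Finset.mem_range.1 hj)]

/-- A positive definite moment sequence of order `2 q` has a quadrature with `q + 1` nonzero
nodes. -/
theorem exists_quadrature {M : ℕ → ℝ} {q : ℕ} (hM : PosDefUpTo (momentFunctional M) q) :
    ∃ z w : Fin (q + 1) → ℝ, Function.Injective z ∧ (∀ i, z i ≠ 0) ∧ (∀ i, 0 < w i) ∧
      ∀ j ≤ 2 * q, M j = ∑ i, w i * z i ^ j := by
  -- The moment of order `2 q + 1` is not prescribed. Varying its value `c` leaves positive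
  -- definiteness intact and is used to move a root away from `0`.
  have key : ∀ c : ℝ, ∃ P : ℝ[X], P.Monic ∧ P.natDegree = q + 1 ∧
      OrthUpTo (momentFunctional (Function.update M (2 * q + 1) c)) q P ∧ (P.eval 0 ≠ 0 →
    ∃ z w : Fin (q + 1) → ℝ, Function.Injective z ∧ (∀ i, z i ≠ 0) ∧ (∀ i, 0 < w i) ∧
      ∀ j ≤ 2 * q, M j = ∑ i, w i * z i ^ j) := by
    intro c
    have hpos : PosDefUpTo (momentFunctional (Function.update M (2 * q + 1) c)) q := by
      intro f hf hd
      rw [momentFunctional_congr (M' := M) (k := 2 * q + 1)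
        (lt_of_le_of_lt natDegree_mul_le (by omega))
        (fun j hj => Function.update_of_ne (by omega) _ _)]
      exact hM f hf hd
    obtain ⟨P, hP, hPd, hPo⟩ := exists_orthogonal hpos
    refine ⟨P, hP, hPd, hPo, fun h0 => ?_⟩
    obtain ⟨z, w, hz, hr, hw, hex⟩ := exists_gauss hpos hP hPd hPo
    refine ⟨z, w, hz, fun i hi => h0 (by have := hr i; rwa [hi] at this), hw, fun j hj => ?_⟩
    have h1 := hex (monomial j 1) ((natDegree_monomial_le _).trans (by omega))
    rw [momentFunctional_monomial, one_mul, Function.update_of_ne (by omega)] at h1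
    simpa using h1
  obtain ⟨P, hP, hPd, hPo, h⟩ := key 0
  obtain ⟨P', hP', hPd', hPo', h'⟩ := key 1
  by_cases h0 : P.eval 0 ≠ 0
  · exact h h0
  by_cases h0' : P'.eval 0 ≠ 0
  · exact h' h0'
  exfalso
  push Not at h0 h0'
  obtain ⟨f, rfl⟩ := dvd_iff_isRoot.2 h0
  obtain ⟨f', rfl⟩ := dvd_iff_isRoot.2 h0'
  simp only [map_zero, sub_zero] at *
  have hf : f.Monic := monic_X.of_mul_monic_left hP
  have hf' : f'.Monic := monic_X.of_mul_monic_left hP'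
  rw [monic_X.natDegree_mul hf, natDegree_X] at hPd
  rw [monic_X.natDegree_mul hf', natDegree_X] at hPd'
  -- If both polynomials vanish at `0`, the two functionals both annihilate the monic `X * f * f'`
  -- of degree `2 q + 1`. They differ on it by the difference `1 - 0` of the top moments.
  have h1 := hPo f' (by omega)
  have h2 := hPo' f (by omega)
  have h3 : (X * f * f').natDegree = 2 * q + 1 := by
    rw [(monic_X.mul hf).natDegree_mul hf', monic_X.natDegree_mul hf, natDegree_X]; omega
  have h4 : (X * f * f').Monic := (monic_X.mul hf).mul hf'
  rw [show X * f' * f = X * f * f' by ring] at h2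
  rw [momentFunctional_eq_sum _ (k := 2 * q + 2) (by omega), Finset.sum_range_succ,
    Function.update_self] at h1 h2
  rw [← h3, h4.coeff_natDegree, h3] at h1 h2
  have h5 : ∀ c : ℝ, ∑ j ∈ Finset.range (2 * q + 1),
      (X * f * f').coeff j * Function.update M (2 * q + 1) c j =
      ∑ j ∈ Finset.range (2 * q + 1), (X * f * f').coeff j * M j := fun c =>
    Finset.sum_congr rfl fun j hj => by
      rw [Function.update_of_ne (Finset.mem_range.1 hj).ne]
  rw [h5] at h1 h2
  linarith

/-- A symmetric positive definite moment sequence of order `2 q`, with `q` even, has a quadrature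
with `q` nonzero nodes and a positive mass at infinity. -/
theorem exists_quadrature_infty {M : ℕ → ℝ} {q : ℕ} (hM : PosDefUpTo (momentFunctional M) q)
    (hq : Even q) (hq0 : q ≠ 0) (hodd : ∀ j, Odd j → M j = 0) :
    ∃ (z w : Fin q → ℝ) (b : ℝ), Function.Injective z ∧ (∀ i, z i ≠ 0) ∧ (∀ i, 0 < w i) ∧ 0 < b ∧
      ∀ j ≤ 2 * q, M j = ∑ i, w i * z i ^ j + if j = 2 * q then b else 0 := by
  obtain ⟨d, rfl⟩ : ∃ d, q = d + 1 := ⟨q - 1, by omega⟩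
  have hpos := hM.mono (Nat.le_succ d)
  obtain ⟨P, hP, hPd, hPo⟩ := exists_orthogonal hpos
  have hsymm : ∀ f : ℝ[X], momentFunctional M (f.comp (-X)) = momentFunctional M f := by
    intro f
    have h1 : (f.comp (-X)).natDegree = f.natDegree := by simp [natDegree_comp]
    rw [momentFunctional_eq_sum M (Nat.lt_succ_self _), h1,
      momentFunctional_eq_sum M (Nat.lt_succ_self f.natDegree)]
    refine Finset.sum_congr rfl fun j _ => ?_
    rw [show (-X : ℝ[X]) = C (-1) * X by simp, comp_C_mul_X_coeff]
    rcases Nat.even_or_odd j with hj | hj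
    · simp [hj.neg_one_pow]
    · simp [hodd j hj]
  have h0 : P.eval 0 ≠ 0 := by
    intro h0
    obtain ⟨f, rfl⟩ := dvd_iff_isRoot.2 h0
    simp only [map_zero, sub_zero] at *
    have hf : f.Monic := monic_X.of_mul_monic_left hP
    rw [monic_X.natDegree_mul hf, natDegree_X] at hPd
    have hfd : f.natDegree = d := by omega
    have hdo : Odd d := by
      rcases Nat.even_or_odd d with h | h
      · exact absurd hq (by simpa [Nat.even_add_one] using h)
      · exact h
    -- Since `d` is odd, the leading terms cancel, so `X * s` has degree at most `d` and is
    -- orthogonal to `X * f`. By symmetry this forces `s = 0`: `f` is odd and vanishes at `0`. Then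
    -- `P = X² h` and `L (f * f) = L (P * h) = 0`, a contradiction.
    set s := f + f.comp (-X) with hs
    have hsd : s.natDegree ≤ d - 1 := by
      rw [natDegree_le_iff_coeff_eq_zero]
      intro N hN
      rw [hs, coeff_add, show (-X : ℝ[X]) = C (-1) * X by simp, comp_C_mul_X_coeff]
      rcases (show d ≤ N by omega).eq_or_lt with rfl | h
      · rw [hdo.neg_one_pow]; ring
      · rw [coeff_eq_zero_of_natDegree_lt (hfd.trans_lt h)]; ring
    have hso : X * s = 0 := by
      by_contra hne
      have hsd' : (X * s).natDegree ≤ d := by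
        refine natDegree_mul_le.trans ?_
        have := hdo.pos
        rw [natDegree_X]; omega
      have h2 := hpos _ hne hsd'
      have h3 : momentFunctional M (X * s * (X * s)) =
          momentFunctional M (X * f * (X * s)) +
            momentFunctional M ((X * f * (X * s)).comp (-X)) := by
        rw [← map_add]
        congr 1
        have : s.comp (-X) = s := by
          rw [hs, add_comp, comp_assoc]; simp [add_comm]
        simp only [mul_comp, X_comp, this]
        rw [hs]; ring
      rw [hsymm, hPo _ hsd'] at h3
      linarith
    have hf0 : f.eval 0 = 0 := by
      have h4 : s = 0 := by simpa using hso
      have h5 := congrArg (eval 0) h4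
      simp only [hs, eval_add, eval_comp, eval_neg, eval_X, neg_zero, eval_zero] at h5
      linarith
    obtain ⟨h, rfl⟩ := dvd_iff_isRoot.2 hf0
    simp only [map_zero, sub_zero] at *
    have h6 := hPo h (by
      have := hfd
      rw [natDegree_mul X_ne_zero (right_ne_zero_of_mul hf.ne_zero)] at this
      omega)
    have h7 := hpos _ hf.ne_zero hfd.le
    rw [show X * h * (X * h) = X * (X * h) * h by ring] at h7
    linarith
  obtain ⟨z, w, hz, hr, hw, hex⟩ := exists_gauss hpos hP hPd hPo
  have hmon : ∀ j ≤ 2 * d + 1, M j = ∑ i, w i * z i ^ j := fun j hj => by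
    have h1 := hex (monomial j 1) ((natDegree_monomial_le _).trans hj)
    rw [momentFunctional_monomial, one_mul] at h1
    simpa using h1
  refine ⟨z, w, M (2 * (d + 1)) - ∑ i, w i * z i ^ (2 * (d + 1)), hz,
    fun i hi => h0 (by have := hr i; rwa [hi] at this), hw, ?_, fun j hj => ?_⟩
  -- The mass at infinity equals `L (P * P)`: apply the Gauss rule to `P * P - X ^ (2 * (d + 1))`,
  -- whose leading terms cancel, and use that `P` vanishes at the nodes.
  · have h1 := hM P hP.ne_zero hPd.le
    have h2 : (P * P - X ^ (2 * (d + 1))).natDegree ≤ 2 * d + 1 := by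
      have hPP : (P * P).natDegree = 2 * (d + 1) := by rw [hP.natDegree_mul hP, hPd]; ring
      rw [natDegree_le_iff_coeff_eq_zero]
      intro N hN
      rw [coeff_sub, coeff_X_pow]
      rcases (show 2 * (d + 1) ≤ N by omega).eq_or_lt with rfl | h
      · rw [if_pos rfl, ← hPP, (hP.mul hP).coeff_natDegree, sub_self]
      · rw [if_neg h.ne', coeff_eq_zero_of_natDegree_lt (hPP.trans_lt h), sub_zero]
    have h3 := hex _ h2
    rw [map_sub] at h3
    simp only [eval_sub, eval_mul, hr, eval_pow, eval_X, mul_zero, zero_sub, mul_neg,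
      Finset.sum_neg_distrib] at h3
    rw [X_pow_eq_monomial, momentFunctional_monomial, one_mul] at h3
    linarith
  · split_ifs with hj'
    · rw [hj']; ring
    · rw [add_zero]; exact hmon j (by omega)

end Gauss

/-! ### Gaussian integrals and spherical means -/

section Gaussian

lemma exists_norm_le_of_mem_homPoly {E : Type} [NormedAddCommGroup E] [NormedSpace ℝ E]
    [FiniteDimensional ℝ E] {k : ℕ} {f : E → ℂ} (hf : f ∈ homPoly E k) :
    ∃ C : ℝ, ∀ x, ‖f x‖ ≤ C * ‖x‖ ^ k := by
  induction hf using Submodule.span_induction with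
  | mem f hf =>
    obtain ⟨a, rfl⟩ := hf
    refine ⟨∏ i, ‖(a i).toContinuousLinearMap‖, fun x => ?_⟩
    have hk : ‖x‖ ^ k = ∏ _i : Fin k, ‖x‖ := by simp
    rw [norm_prod, hk, ← Finset.prod_mul_distrib]
    refine Finset.prod_le_prod (fun _ _ => norm_nonneg _) fun i _ => ?_
    rw [Complex.norm_real]
    exact (a i).toContinuousLinearMap.le_opNorm x
  | zero => exact ⟨0, by simp⟩
  | add f g _ _ h1 h2 =>
    obtain ⟨C, hC⟩ := h1
    obtain ⟨D, hD⟩ := h2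
    exact ⟨C + D, fun x =>
      (norm_add_le _ _).trans (by rw [add_mul]; exact add_le_add (hC x) (hD x))⟩
  | smul r f _ h =>
    obtain ⟨C, hC⟩ := h
    refine ⟨‖r‖ * C, fun x => ?_⟩
    rw [Pi.smul_apply, norm_smul, mul_assoc]
    exact mul_le_mul_of_nonneg_left (hC x) (norm_nonneg r)

variable (E : Type) [NormedAddCommGroup E] [InnerProductSpace ℝ E] [FiniteDimensional ℝ E]
  [MeasurableSpace E] [BorelSpace E]

/-- The moments of the norm with respect to the Gaussian weight `exp (-‖x‖²)`. -/
def gaussMoment (k : ℕ) : ℝ := ∫ x : E, ‖x‖ ^ k * Real.exp (-‖x‖ ^ 2)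

variable {E}

/-- The integral against the Gaussian weight `exp (-‖x‖²)`. -/
def gaussIntegral (f : E → ℂ) : ℂ := ∫ x : E, f x * (Real.exp (-‖x‖ ^ 2) : ℂ)

variable [Nontrivial E]

lemma integrable_norm_pow_gauss (k : ℕ) :
    Integrable fun x : E => ‖x‖ ^ k * Real.exp (-‖x‖ ^ 2) := by
  rw [integrable_fun_norm_addHaar volume (f := fun r : ℝ => r ^ k * Real.exp (-r ^ 2))]
  have h := integrableOn_rpow_mul_exp_neg_mul_sq (b := 1) one_pos
    (s := ((finrank ℝ E - 1 + k : ℕ) : ℝ)) (lt_of_lt_of_le (by norm_num) (Nat.cast_nonneg _))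
  refine h.congr_fun (fun y _ => ?_) measurableSet_Ioi
  simp only [Real.rpow_natCast, smul_eq_mul, pow_add, neg_mul, one_mul]
  ring

lemma gaussMoment_pos (k : ℕ) : 0 < gaussMoment E k := by
  obtain ⟨x, hx⟩ := exists_ne (0 : E)
  refine integral_pos_of_integrable_nonneg_nonzero (x := x) (by fun_prop)
    (integrable_norm_pow_gauss k) (fun x => by positivity) ?_
  have := norm_pos_iff.2 hx
  positivity

lemma integrable_gauss_of_mem_homPoly {k : ℕ} {f : E → ℂ} (hf : f ∈ homPoly E k) :
    Integrable fun x : E => f x * (Real.exp (-‖x‖ ^ 2) : ℂ) := by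
  obtain ⟨C, hC⟩ := exists_norm_le_of_mem_homPoly hf
  have hc := continuous_of_mem_homPoly hf
  refine ((integrable_norm_pow_gauss (E := E) k).const_mul C).mono'
    (Continuous.aestronglyMeasurable (by fun_prop)) (.of_forall fun x => ?_)
  rw [norm_mul, Complex.norm_real, Real.norm_of_nonneg (Real.exp_pos _).le, ← mul_assoc]
  exact mul_le_mul_of_nonneg_right (hC x) (Real.exp_pos _).le

/-- The Gaussian integral of a homogeneous function in polar coordinates. -/
lemma gaussIntegral_eq_toSphere {k : ℕ} {f : E → ℂ}
    (hf : ∀ (r : ℝ) (x : E), 0 < r → f (r • x) = (r : ℂ) ^ k * f x) :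
    gaussIntegral f = (∫ u, f u ∂(volume : Measure E).toSphere) *
      ((∫ r : Set.Ioi (0 : ℝ), (r : ℝ) ^ k * Real.exp (-(r : ℝ) ^ 2)
        ∂.volumeIoiPow (finrank ℝ E - 1) : ℝ) : ℂ) := by
  set μ : Measure E := volume
  calc
    gaussIntegral f = ∫ x : ({(0)}ᶜ : Set E), f x * (Real.exp (-‖(x : E)‖ ^ 2) : ℂ)
        ∂(μ.comap (↑)) := by
      rw [integral_subtype_comap (measurableSet_singleton _).compl
        fun x : E => f x * (Real.exp (-‖x‖ ^ 2) : ℂ), restrict_compl_singleton]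
      rfl
    _ = ∫ z, f z.1 * ((((z.2 : ℝ) ^ k * Real.exp (-(z.2 : ℝ) ^ 2) : ℝ)) : ℂ)
        ∂μ.toSphere.prod (.volumeIoiPow (finrank ℝ E - 1)) := by
      rw [← μ.measurePreserving_homeomorphUnitSphereProd.integral_comp
        (Homeomorph.measurableEmbedding _)]
      refine integral_congr_ae (.of_forall fun x => ?_)
      have hx : 0 < ‖(x : E)‖ := norm_pos_iff.2 x.2
      have h1 : (x : E) = ‖(x : E)‖ • ((homeomorphUnitSphereProd E x).1 : E) := by
        simp [smul_smul, hx.ne']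
      simp only [homeomorphUnitSphereProd_apply_snd_coe]
      conv_lhs => rw [h1, hf _ _ hx, ← h1]
      push_cast
      ring
    _ = _ := by
      rw [integral_prod_mul (fun u : Metric.sphere (0 : E) 1 => f u)
        (fun r : Set.Ioi (0 : ℝ) => ((((r : ℝ) ^ k * Real.exp (-(r : ℝ) ^ 2) : ℝ)) : ℂ)),
        integral_complex_ofReal]

/-- The surface measure of the unit sphere, normalized to total mass one. -/
def unitSphereMeasure (E : Type) [NormedAddCommGroup E] [InnerProductSpace ℝ E]
    [FiniteDimensional ℝ E] [MeasurableSpace E] [BorelSpace E] :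
    Measure (Metric.sphere (0 : E) 1) :=
  ((volume : Measure E).toSphere Set.univ)⁻¹ • (volume : Measure E).toSphere

instance : IsProbabilityMeasure (unitSphereMeasure E) where
  measure_univ := by
    rw [unitSphereMeasure, Measure.smul_apply, smul_eq_mul]
    exact ENNReal.inv_mul_cancel (Measure.measure_univ_ne_zero.2 (Measure.toSphere_ne_zero _))
      (measure_ne_top _ _)

/-- The Gaussian integral of a homogeneous function is a multiple of its mean over the sphere. -/
lemma gaussIntegral_eq_sphere {k : ℕ} {f : E → ℂ} (hf : f ∈ homPoly E k) :
    gaussIntegral f = gaussMoment E k * ∫ u, f u ∂(unitSphereMeasure E) := by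
  -- Testing with `‖x‖ ^ k`, which is `1` on the sphere, identifies the radial factor.
  have h1 := gaussIntegral_eq_toSphere (E := E) (k := k) (f := fun x => ((‖x‖ ^ k : ℝ) : ℂ))
    fun r x hr => by
      rw [norm_smul, Real.norm_of_nonneg hr.le, mul_pow]; push_cast; ring
  have h2 : gaussIntegral (fun x : E => ((‖x‖ ^ k : ℝ) : ℂ)) = gaussMoment E k := by
    rw [gaussMoment, ← integral_complex_ofReal, gaussIntegral]
    simp only [Complex.ofReal_mul]
  rw [h2] at h1
  rw [gaussIntegral_eq_toSphere (k := k) fun r x _ => homPoly_map_smul hf r x, h1,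
    unitSphereMeasure, integral_smul_measure]
  have h3 : ∫ u : Metric.sphere (0 : E) 1, ((‖(u : E)‖ ^ k : ℝ) : ℂ)
      ∂(volume : Measure E).toSphere = ((volume : Measure E).toSphere.real Set.univ : ℂ) := by
    simp
  have h4 : (volume : Measure E).toSphere.real Set.univ ≠ 0 := by
    rw [Measure.real, ENNReal.toReal_ne_zero]
    exact ⟨Measure.measure_univ_ne_zero.2 (Measure.toSphere_ne_zero _), measure_ne_top _ _⟩
  rw [h3, ENNReal.toReal_inv, Complex.real_smul]
  rw [Measure.real] at *
  have h5 : (((volume : Measure E).toSphere Set.univ).toReal : ℂ) ≠ 0 := by exact_mod_cast h4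
  push_cast
  field_simp

omit [Nontrivial E] in
lemma gaussIntegral_comp_isometry (f : E → ℂ) (U : E ≃ₗᵢ[ℝ] E) :
    gaussIntegral (fun x => f (U x)) = gaussIntegral f := by
  have := U.measurePreserving.integral_comp U.toHomeomorph.measurableEmbedding
    fun x : E => f x * (Real.exp (-‖x‖ ^ 2) : ℂ)
  simpa [gaussIntegral] using this

omit [Nontrivial E] in
lemma gaussIntegral_eq_zero_of_odd {k : ℕ} (hk : Odd k) {f : E → ℂ} (hf : f ∈ homPoly E k) :
    gaussIntegral f = 0 := by
  have h := gaussIntegral_comp_isometry f (LinearIsometryEquiv.neg ℝ)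
  have h1 : (fun x => f (LinearIsometryEquiv.neg ℝ x)) = fun x => -f x := by
    ext x
    have := homPoly_map_smul hf (-1) x
    rw [neg_one_smul] at this
    simp [this, hk.neg_one_pow]
  rw [h1] at h
  simp only [gaussIntegral, neg_mul, integral_neg] at h ⊢
  exact self_eq_neg.1 h.symm

/-- Hilbert's identity: the mean of an even power of a linear form is a power of its norm. -/
lemma exists_gaussIntegral_inner_pow {q : ℕ} (hq : Even q) :
    ∃ c : ℝ, 0 < c ∧ ∀ v : E, gaussIntegral (fun x => ((inner ℝ v x : ℝ) : ℂ) ^ q) =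
      ((c * ‖v‖ ^ q : ℝ) : ℂ) := by
  obtain ⟨e, he⟩ := exists_norm_eq E zero_le_one
  have hint := integrable_gauss_of_mem_homPoly (form_pow_mem_homPoly (innerₛₗ ℝ e) q)
  have hreal : ∀ v : E, gaussIntegral (fun x => ((inner ℝ v x : ℝ) : ℂ) ^ q) =
      ((∫ x, (inner ℝ v x) ^ q * Real.exp (-‖x‖ ^ 2) : ℝ) : ℂ) := by
    intro v
    rw [gaussIntegral, ← integral_complex_ofReal]
    push_cast
    rfl
  refine ⟨∫ x, (inner ℝ e x) ^ q * Real.exp (-‖x‖ ^ 2), ?_, fun v => ?_⟩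
  · simp only [innerₛₗ_apply_apply, ← Complex.ofReal_pow, ← Complex.ofReal_mul] at hint
    refine integral_pos_of_integrable_nonneg_nonzero (x := e) (by fun_prop) hint.re
      (fun x => mul_nonneg (hq.pow_nonneg _) (Real.exp_pos _).le) ?_
    rw [real_inner_self_eq_norm_sq, he]
    simp
  -- This reflection exchanges the vectors `‖v‖ • e` and `v` of equal norm, so rotation invariance
  -- reduces to `e`.
  · set U := (Submodule.span ℝ {‖v‖ • e - v})ᗮ.reflection with hU
    have hUe : U (‖v‖ • e) = v := Submodule.reflection_sub (by simp [norm_smul, he])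
    rw [← gaussIntegral_comp_isometry _ U]
    have h1 : ∀ x, inner ℝ v (U x) = ‖v‖ * inner ℝ e x := by
      intro x
      rw [← hUe, LinearIsometryEquiv.inner_map_map, inner_smul_left, hUe]
      simp
    simp only [h1]
    rw [Complex.ofReal_mul, ← hreal e]
    simp only [gaussIntegral, ← integral_mul_const]
    refine integral_congr_ae (.of_forall fun x => ?_)
    push_cast
    ring

end Gaussian

/-! ### Fubini for an orthogonal sum -/

section Product

variable {E F G : Type} [NormedAddCommGroup E] [InnerProductSpace ℝ E] [FiniteDimensional ℝ E]
  [MeasurableSpace E] [BorelSpace E] [NormedAddCommGroup F] [InnerProductSpace ℝ F]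
  [FiniteDimensional ℝ F] [MeasurableSpace F] [BorelSpace F]
  [NormedAddCommGroup G] [InnerProductSpace ℝ G]
  [FiniteDimensional ℝ G] [MeasurableSpace G] [BorelSpace G] [Nontrivial E] [Nontrivial F]

/-- Fubini's theorem for the Gaussian integral over an orthogonal sum, up to the normalization
of the Haar measure. -/
lemma exists_gaussIntegral_prod (T : G ≃L[ℝ] E × F)
    (hT : ∀ x, ‖x‖ ^ 2 = ‖(T x).1‖ ^ 2 + ‖(T x).2‖ ^ 2) :
    ∃ c : ℝ, 0 < c ∧ ∀ (k : ℕ) (f : E × F → ℂ), f ∈ homPoly (E × F) k →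
      gaussIntegral (fun x => f (T x)) =
        c * gaussIntegral fun y => gaussIntegral fun x => f (x, y) := by
  have hH : ((volume : Measure G).map T).IsAddHaarMeasure := T.isAddHaarMeasure_map _
  set c := ((volume : Measure G).map T).addHaarScalarFactor
    ((volume : Measure E).prod (volume : Measure F)) with hc
  have hmap : (volume : Measure G).map T =
      c • ((volume : Measure E).prod (volume : Measure F)) :=
    Measure.isAddLeftInvariant_eq_smul _ _
  refine ⟨c, ?_, fun k f hf => ?_⟩
  · exact_mod_cast Measure.addHaarScalarFactor_pos_of_isAddHaarMeasure _ _
  have h1 : gaussIntegral (fun x => f (T x)) =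
      ∫ z, f z * (Real.exp (-(‖z.1‖ ^ 2 + ‖z.2‖ ^ 2)) : ℂ) ∂((volume : Measure G).map T) := by
    rw [show (T : G → E × F) = T.toHomeomorph from rfl,
      T.toHomeomorph.measurableEmbedding.integral_map]
    simp only [gaussIntegral, hT]
    rfl
  have hint : Integrable (fun z : E × F => f z * (Real.exp (-(‖z.1‖ ^ 2 + ‖z.2‖ ^ 2)) : ℂ))
      ((volume : Measure E).prod (volume : Measure F)) := by
    obtain ⟨C, hC⟩ := exists_norm_le_of_mem_homPoly hf
    have hcont := continuous_of_mem_homPoly hf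
    have hE := fun j => integrable_norm_pow_gauss (E := E) j
    have hF := fun j => integrable_norm_pow_gauss (E := F) j
    refine (((hE k).mul_prod (hF 0)).add ((hE 0).mul_prod (hF k))).const_mul |C| |>.mono'
      (Continuous.aestronglyMeasurable (by fun_prop)) (.of_forall fun z => ?_)
    -- The product carries the maximum norm, whereas the Gaussian weight uses the sum of squares.
    have hz : ‖z‖ ^ k ≤ ‖z.1‖ ^ k + ‖z.2‖ ^ k := by
      rcases max_choice ‖z.1‖ ‖z.2‖ with h | h
      · rw [Prod.norm_def, h]
        exact le_add_of_nonneg_right (by positivity)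
      · rw [Prod.norm_def, h]
        exact le_add_of_nonneg_left (by positivity)
    have hexp := Real.exp_pos (-(‖z.1‖ ^ 2 + ‖z.2‖ ^ 2))
    have hle : C * ‖z‖ ^ k ≤ |C| * (‖z.1‖ ^ k + ‖z.2‖ ^ k) :=
      mul_le_mul (le_abs_self C) hz (by positivity) (abs_nonneg C)
    rw [norm_mul, Complex.norm_real, Real.norm_of_nonneg hexp.le]
    refine (mul_le_mul_of_nonneg_right ((hC z).trans hle) hexp.le).trans_eq ?_
    rw [neg_add, Real.exp_add]
    simp only [Pi.add_apply, pow_zero]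
    ring
  rw [h1, hmap, integral_smul_nnreal_measure, integral_prod_symm _ hint, NNReal.smul_def,
    Complex.real_smul]
  congr 1
  refine integral_congr_ae (.of_forall fun y => ?_)
  simp only [gaussIntegral, ← integral_mul_const]
  refine integral_congr_ae (.of_forall fun x => ?_)
  simp only [neg_add, Real.exp_add, Complex.ofReal_mul]
  ring

end Product

/-! ### Compactness of convex hulls -/

section ConvexHull

/-- By Carathéodory, `finrank + 1` points suffice for each convex combination, so the hull is a
continuous image of a simplex times a power of `s`. Shorter combinations are padded with weight `0`
at `x₀`. -/
lemma isCompact_convexHull_of_finiteDimensional {W : Type} [NormedAddCommGroup W] [NormedSpace ℝ W]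
    [FiniteDimensional ℝ W] {s : Set W} (hs : IsCompact s) : IsCompact (convexHull ℝ s) := by
  rcases s.eq_empty_or_nonempty with rfl | ⟨x₀, hx₀⟩
  · simp
  set N := finrank ℝ W + 1
  have himg : convexHull ℝ s = (fun y : (Fin N → ℝ) × (Fin N → W) => ∑ i, y.1 i • y.2 i) ''
      (stdSimplex ℝ (Fin N) ×ˢ Set.pi Set.univ fun _ => s) := by
    apply Set.Subset.antisymm
    · intro x hx
      obtain ⟨ι, _, z, w, hz, hind, hw, hw1, hx⟩ := eq_pos_convex_span_of_mem_convexHull hx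
      have hcard : Fintype.card ι ≤ Fintype.card (Fin N) := by
        simpa [N] using hind.card_le_finrank_succ.trans
          (Nat.add_le_add_right (Submodule.finrank_le _) 1)
      obtain ⟨e⟩ := Function.Embedding.nonempty_of_card_le hcard
      have hext : ∀ i, Function.extend e w 0 (e i) = w i := e.injective.extend_apply w 0
      have hexz : ∀ i, Function.extend e z (fun _ => x₀) (e i) = z i :=
        e.injective.extend_apply z _
      have h0 : ∀ j, j ∉ Set.range e → Function.extend e w 0 j = 0 := fun j hj =>
        Function.extend_apply' _ _ _ hj
      refine ⟨(Function.extend e w 0, Function.extend e z fun _ => x₀), ⟨⟨fun j => ?_, ?_⟩, ?_⟩, ?_⟩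
      · by_cases hj : j ∈ Set.range e
        · obtain ⟨i, rfl⟩ := hj
          exact (hw i).le.trans_eq (hext i).symm
        · exact (h0 j hj).ge
      · rw [← hw1]
        exact (Fintype.sum_of_injective e e.injective _ _ h0 fun i => (hext i).symm).symm
      · intro j _
        by_cases hj : j ∈ Set.range e
        · obtain ⟨i, rfl⟩ := hj
          simp only [hexz]
          exact hz ⟨i, rfl⟩
        · simp only [Function.extend_apply' _ _ _ hj]
          exact hx₀
      · rw [← hx]
        exact (Fintype.sum_of_injective e e.injective _ _ (fun j hj => by simp [h0 j hj])
          fun i => by simp [hext, hexz]).symm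
    · rintro _ ⟨⟨w, z⟩, ⟨hw, hz⟩, rfl⟩
      exact (convex_convexHull ℝ s).sum_mem (fun i _ => hw.1 i) hw.2
        fun i _ => subset_convexHull ℝ s (hz i (Set.mem_univ i))
  rw [himg]
  exact ((isCompact_stdSimplex ℝ (Fin N)).prod (isCompact_univ_pi fun _ => hs)).image (by fun_prop)

end ConvexHull

/-! ### Isometric embeddings and spherical designs -/

section Designs

variable {E : Type} [NormedAddCommGroup E] [InnerProductSpace ℝ E]

/-- The vectors `a` give a representation `∑ ⟨a_l, v⟩^q = ‖v‖^q`. -/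
def IsPowerFrame (q : ℕ) {ι : Type} [Fintype ι] (a : ι → E) : Prop :=
  ∀ v : E, ∑ l, (inner ℝ (a l) v : ℝ) ^ q = ‖v‖ ^ q

lemma exists_isPowerFrame_fin {q : ℕ} {ι : Type} [Fintype ι] {a : ι → E} (ha : IsPowerFrame q a) :
    ∃ b : Fin (Fintype.card ι) → E, IsPowerFrame q b :=
  ⟨a ∘ (Fintype.equivFin ι).symm, fun v => by
    rw [← ha v]
    exact (Fintype.equivFin ι).symm.sum_comp fun l => (inner ℝ (a l) v : ℝ) ^ q⟩

/-- Guarantees that the set defining `minReal` is nonempty, so that its `sInf` is attained. The mean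
over the sphere of the tensor power `Ψ` lies in the convex hull of its values, hence is a finite
convex combination of them; pairing with `v` turns Hilbert's identity into a finite sum. -/
lemma exists_isPowerFrame [FiniteDimensional ℝ E] [Nontrivial E] {q : ℕ} (hq : Even q)
    (hq0 : q ≠ 0) :
    ∃ (n : ℕ) (a : Fin n → E), IsPowerFrame q a := by
  let _ : MeasurableSpace E := borel E
  have : BorelSpace E := ⟨rfl⟩
  obtain ⟨c, hc, hcv⟩ := exists_gaussIntegral_inner_pow (E := E) hq
  set b := stdOrthonormalBasis ℝ E
  set G := gaussMoment E q
  have hG : 0 < G := gaussMoment_pos q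
  let Ψ : E → ((Fin q → Fin (finrank ℝ E)) → ℝ) := fun u I => ∏ t, inner ℝ (b (I t)) u
  have hΨ : Continuous Ψ := by fun_prop
  let Λ : E → ((Fin q → Fin (finrank ℝ E)) → ℝ) →L[ℝ] ℝ := fun v =>
    LinearMap.toContinuousLinearMap
      (∑ I, (∏ t, inner ℝ (b (I t)) v : ℝ) • LinearMap.proj I)
  have hΛ : ∀ u v, Λ v (Ψ u) = (inner ℝ v u) ^ q := by
    intro u v
    rw [← b.sum_inner_mul_inner v u, Fintype.sum_pow]
    simp only [Λ, Ψ, LinearMap.coe_toContinuousLinearMap', LinearMap.sum_apply,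
      LinearMap.smul_apply, LinearMap.proj_apply, smul_eq_mul, ← Finset.prod_mul_distrib]
    simp only [real_inner_comm]
  have hcpt : IsCompact (Ψ '' Metric.sphere (0 : E) 1) := (isCompact_sphere 0 1).image hΨ
  have hint : Integrable (fun u : Metric.sphere (0 : E) 1 => Ψ u) (unitSphereMeasure E) :=
    (hΨ.comp continuous_subtype_val).integrable_of_hasCompactSupport
      (HasCompactSupport.of_compactSpace _)
  have hmem : ∫ u : Metric.sphere (0 : E) 1, Ψ u ∂(unitSphereMeasure E) ∈
      convexHull ℝ (Ψ '' Metric.sphere (0 : E) 1) :=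
    (convex_convexHull ℝ _).integral_mem
      (isCompact_convexHull_of_finiteDimensional hcpt).isClosed
      (.of_forall fun u => subset_convexHull ℝ _ ⟨u, u.2, rfl⟩) hint
  obtain ⟨ι, _, z, w, hz, -, hw, -, hx⟩ := eq_pos_convex_span_of_mem_convexHull hmem
  choose u _ hu using fun i => hz ⟨i, rfl⟩
  have hval : ∀ v, ∫ u : Metric.sphere (0 : E) 1, (inner ℝ v (u : E) : ℝ) ^ q
      ∂(unitSphereMeasure E) = c / G * ‖v‖ ^ q := by
    intro v
    have h1 := gaussIntegral_eq_sphere (form_pow_mem_homPoly (innerₛₗ ℝ v) q)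
    simp only [innerₛₗ_apply_apply, hcv] at h1
    simp only [← Complex.ofReal_pow, integral_complex_ofReal] at h1
    have h2 : c * ‖v‖ ^ q = G * ∫ u : Metric.sphere (0 : E) 1, (inner ℝ v (u : E) : ℝ) ^ q
      ∂(unitSphereMeasure E) := by exact_mod_cast h1
    rw [div_mul_eq_mul_div, h2, mul_div_cancel_left₀ _ hG.ne']
  have hsum : ∀ v, ∑ i, w i * (inner ℝ (u i) v) ^ q = c / G * ‖v‖ ^ q := by
    intro v
    rw [← hval v]
    simp only [← fun u => hΛ u v]
    rw [(Λ v).integral_comp_comm hint, ← hx, map_sum]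
    refine Finset.sum_congr rfl fun i _ => ?_
    rw [map_smul, ← hu i, hΛ, smul_eq_mul, real_inner_comm]
  -- The positive weights are absorbed into the vectors by taking `q`-th roots.
  have hframe : IsPowerFrame q fun i => ((G / c * w i) ^ ((q : ℝ)⁻¹)) • u i := by
    intro v
    simp only [inner_smul_left, mul_pow, RCLike.conj_to_real]
    have : ∀ i, ((G / c * w i) ^ ((q : ℝ)⁻¹)) ^ q = G / c * w i := fun i =>
      Real.rpow_inv_natCast_pow (by have := hw i; positivity) hq0
    simp only [this, mul_assoc]
    rw [← Finset.mul_sum, hsum]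
    field_simp
  obtain ⟨a, ha⟩ := exists_isPowerFrame_fin hframe
  exact ⟨_, a, ha⟩

lemma IsPowerFrame.comp_isometry {F : Type} [NormedAddCommGroup F] [InnerProductSpace ℝ F]
    {q : ℕ} {ι : Type} [Fintype ι] {a : ι → E} (ha : IsPowerFrame q a)
    (U : E ≃ₗᵢ[ℝ] F) : IsPowerFrame q fun l => U (a l) := by
  intro v
  rw [← U.symm.norm_map v, ← ha]
  refine Finset.sum_congr rfl fun l _ => ?_
  rw [← U.symm.inner_map_map, U.symm_apply_apply]

/-- The coordinates of an embedding are linear forms, represented by vectors `a l`; for even `q` the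
`q`-th power of the `ℓ_q` norm needs no absolute values. -/
lemma hasIsometricEmbedding_iff {m q n : ℕ} (hq : Even q) (hq0 : q ≠ 0) :
    HasIsometricEmbedding m q n ↔
      ∃ a : Fin n → EuclideanSpace ℝ (Fin m), IsPowerFrame q a := by
  have hnorm : ∀ y : PiLp (q : ℝ≥0∞) (fun _ : Fin n => ℝ), ‖y‖ ^ q = ∑ l, y l ^ q := by
    intro y
    rw [PiLp.norm_eq_sum (by simpa using Nat.pos_of_ne_zero hq0)]
    simp only [ENNReal.toReal_natCast, Real.rpow_natCast, one_div]
    rw [Real.rpow_inv_natCast_pow (by positivity) hq0]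
    simp [hq.pow_abs]
  have hnn : ∀ y : PiLp (q : ℝ≥0∞) (fun _ : Fin n => ℝ), 0 ≤ ‖y‖ := by
    intro y
    rw [PiLp.norm_eq_sum (by simpa using Nat.pos_of_ne_zero hq0)]
    positivity
  constructor
  · rintro ⟨T, hT⟩
    let a : Fin n → EuclideanSpace ℝ (Fin m) := fun l =>
      (InnerProductSpace.toDual ℝ _).symm (LinearMap.toContinuousLinearMap
        ((LinearMap.proj l).comp ((WithLp.linearEquiv _ ℝ (Fin n → ℝ)).toLinearMap.comp T)))
    refine ⟨a, fun v => ?_⟩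
    rw [← hT v, hnorm]
    refine Finset.sum_congr rfl fun l _ => ?_
    rw [InnerProductSpace.toDual_symm_apply]
    rfl
  · rintro ⟨a, ha⟩
    refine ⟨(WithLp.linearEquiv _ ℝ (Fin n → ℝ)).symm.toLinearMap.comp
      (LinearMap.pi fun l => innerₛₗ ℝ (a l)), fun v => ?_⟩
    refine (pow_left_inj₀ (hnn _) (norm_nonneg v) hq0).1 ?_
    rw [hnorm, ← ha v]
    rfl

/-- A frame with two proportional vectors can be shortened. -/
lemma IsPowerFrame.remove {q n : ℕ} (hq : Even q) (hq0 : q ≠ 0) {a : Fin (n + 1) → E}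
    (ha : IsPowerFrame q a) {l l' : Fin (n + 1)} (hl : l' ≠ l) {t : ℝ} (h : a l = t • a l') :
    ∃ b : Fin n → E, IsPowerFrame q b := by
  obtain ⟨k, rfl⟩ := Fin.exists_succAbove_eq hl
  refine ⟨Function.update (fun j => a (l.succAbove j)) k
    (((1 + t ^ q) ^ ((q : ℝ)⁻¹)) • a (l.succAbove k)), fun v => ?_⟩
  have ht := hq.pow_nonneg t
  rw [← ha v, Fin.sum_univ_succAbove _ l, h,
    ← Finset.add_sum_erase _ _ (Finset.mem_univ k),
    ← Finset.add_sum_erase (Finset.univ : Finset (Fin n)) _ (Finset.mem_univ k),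
    Function.update_self, ← add_assoc]
  congr 1
  · simp only [inner_smul_left, mul_pow, RCLike.conj_to_real]
    rw [Real.rpow_inv_natCast_pow (by positivity) hq0]
    ring
  · refine Finset.sum_congr rfl fun j hj => ?_
    rw [Function.update_of_ne (Finset.ne_of_mem_erase hj)]

lemma IsPowerFrame.remove_zero {q n : ℕ} (hq0 : q ≠ 0) {a : Fin (n + 1) → E}
    (ha : IsPowerFrame q a) {l : Fin (n + 1)} (h : a l = 0) :
    ∃ b : Fin n → E, IsPowerFrame q b := by
  refine ⟨fun j => a (l.succAbove j), fun v => ?_⟩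
  rw [← ha v, Fin.sum_univ_succAbove _ l, h]
  simp [hq0]

variable (E) in
/-- A minimal frame consists of nonzero pairwise non-proportional vectors. -/
lemma exists_minimal_isPowerFrame [FiniteDimensional ℝ E] [Nontrivial E] {q : ℕ} (hq : Even q)
    (hq0 : q ≠ 0) :
    ∃ a : Fin (minReal (finrank ℝ E) q) → E, IsPowerFrame q a ∧ (∀ l, a l ≠ 0) ∧
      ∀ l l', l ≠ l' → ∀ t : ℝ, a l ≠ t • a l' := by
  have hiff : ∀ n, HasIsometricEmbedding (finrank ℝ E) q n ↔
      ∃ a : Fin n → E, IsPowerFrame q a := by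
    intro n
    rw [hasIsometricEmbedding_iff hq hq0]
    exact ⟨fun ⟨a, ha⟩ => ⟨_, ha.comp_isometry (stdOrthonormalBasis ℝ E).repr.symm⟩,
      fun ⟨a, ha⟩ => ⟨_, ha.comp_isometry (stdOrthonormalBasis ℝ E).repr⟩⟩
  have hne : {n | HasIsometricEmbedding (finrank ℝ E) q n}.Nonempty := by
    obtain ⟨n, a, ha⟩ := exists_isPowerFrame (E := E) hq hq0
    exact ⟨n, (hiff n).2 ⟨a, ha⟩⟩
  have hmem : HasIsometricEmbedding (finrank ℝ E) q (minReal (finrank ℝ E) q) := Nat.sInf_mem hne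
  have hmin : ∀ n, (∃ a : Fin n → E, IsPowerFrame q a) → minReal (finrank ℝ E) q ≤ n :=
    fun n hn => Nat.sInf_le ((hiff n).2 hn)
  obtain ⟨a, ha⟩ := (hiff _).1 hmem
  refine ⟨a, ha, ?_⟩
  generalize minReal (finrank ℝ E) q = N at a ha hmin
  rcases N with _ | n
  · exact ⟨fun l => l.elim0, fun l => l.elim0⟩
  · exact ⟨fun l hl => absurd (hmin n (ha.remove_zero hq0 hl)) (by omega),
      fun l l' hl t ht => absurd (hmin n (ha.remove hq hq0 hl.symm ht)) (by omega)⟩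

variable (E) in
/-- The spherical cubature formula defined by a minimal isometric embedding. -/
lemma exists_design [FiniteDimensional ℝ E] [Nontrivial E] [MeasurableSpace E] [BorelSpace E]
    {q : ℕ} (hq : Even q)
    (hq0 : q ≠ 0) :
    ∃ (u : Fin (minReal (finrank ℝ E) q) → E) (lam : Fin (minReal (finrank ℝ E) q) → ℝ),
      (∀ l, ‖u l‖ = 1) ∧ (∀ l, 0 < lam l) ∧ (∀ l l', l ≠ l' → ∀ t : ℝ, u l ≠ t • u l') ∧
      ∀ j ≤ q, Even j → ∀ f ∈ homPoly E j,
        ∫ x : Metric.sphere (0 : E) 1, f x ∂(unitSphereMeasure E) =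
          ∑ l, (lam l : ℂ) * f (u l) := by
  obtain ⟨a, ha, ha0, hap⟩ := exists_minimal_isPowerFrame E hq hq0
  obtain ⟨c, hc, hcv⟩ := exists_gaussIntegral_inner_pow (E := E) hq
  set G := gaussMoment E q
  have hG : 0 < G := gaussMoment_pos q
  have hn : ∀ l, ‖a l‖ ≠ 0 := fun l => norm_ne_zero_iff.2 (ha0 l)
  set u := fun l => ‖a l‖⁻¹ • a l with hu
  set lam := fun l => c / G * ‖a l‖ ^ q with hlam
  have hu1 : ∀ l, ‖u l‖ = 1 := fun l => by simp [hu, norm_smul, hn l]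
  -- By polarization it is enough to test powers of linear forms, where exactness is Hilbert's
  -- identity combined with the frame identity.
  have htop : ∀ f ∈ homPoly E q, gaussIntegral f = G * ∑ l, (lam l : ℂ) * f (u l) := by
    intro f hf
    have hint : ∀ g ∈ homPoly E q, Integrable fun x : E => g x * (Real.exp (-‖x‖ ^ 2) : ℂ) :=
      fun g hg => integrable_gauss_of_mem_homPoly hg
    rw [homPoly_eq_span_pow] at hf hint
    induction hf using Submodule.span_induction with
    | mem f hf =>
      obtain ⟨ℓ, rfl⟩ := hf
      set v := (InnerProductSpace.toDual ℝ E).symm (LinearMap.toContinuousLinearMap ℓ) with hv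
      have hℓ : ∀ x, ℓ x = inner ℝ v x := fun x => by
        rw [hv, InnerProductSpace.toDual_symm_apply]; rfl
      simp only [hℓ, hcv, ← ha v]
      have : ∀ l, lam l * (inner ℝ v (u l)) ^ q = c / G * (inner ℝ (a l) v) ^ q := fun l => by
        simp only [hlam, hu]
        rw [inner_smul_right, mul_pow, real_inner_comm, inv_pow]
        field_simp [hn l]
      simp only [← Complex.ofReal_pow, ← Complex.ofReal_mul, ← Complex.ofReal_sum, this,
        ← Finset.mul_sum]
      congr 1
      field_simp
    | zero => simp [gaussIntegral]
    | add f g hf hg h1 h2 =>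
      have := integral_add (hint f hf) (hint g hg)
      simp only [gaussIntegral, Pi.add_apply, add_mul, mul_add, Finset.sum_add_distrib] at *
      rw [this, h1, h2]
    | smul r f hf h =>
      simp only [gaussIntegral, Pi.smul_apply, smul_eq_mul, mul_assoc, integral_const_mul] at *
      rw [h, ← mul_assoc, mul_comm r, mul_assoc, Finset.mul_sum]
      congr 1
      exact Finset.sum_congr rfl fun l _ => by ring
  refine ⟨u, lam, hu1, fun l => by have := hn l; positivity, fun l l' hl t ht => ?_, ?_⟩
  · apply hap l l' hl (‖a l‖ * t * ‖a l'‖⁻¹)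
    simp only [hu] at ht
    rw [mul_smul, mul_smul, ← ht, smul_smul, mul_inv_cancel₀ (hn l), one_smul]
  · intro j hj hje f hf
    have h1 : f * (fun x : E => ((‖x‖ ^ (q - j) : ℝ) : ℂ)) ∈ homPoly E q := by
      have := mul_mem_homPoly hf (norm_pow_mem_homPoly (E := E) (j := q - j)
        (by rw [Nat.even_sub hj]; tauto))
      rwa [Nat.add_sub_cancel' hj] at this
    have h2 := htop _ h1
    have hGc : (G : ℂ) ≠ 0 := by exact_mod_cast hG.ne'
    rw [gaussIntegral_eq_sphere h1, mul_right_inj' hGc] at h2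
    simpa [hu1] using h2

end Designs

/-! ### Right multiplication and the splitting of the space -/

section Vec

variable {K : Type} [NormedDivisionRing K] {m : ℕ}

lemma norm_rmul (x : Vec K m) (α : K) : ‖rmul x α‖ = ‖x‖ * ‖α‖ := by
  rw [← sq_eq_sq₀ (norm_nonneg _) (by positivity), mul_pow, PiLp.norm_sq_eq_of_L2,
    PiLp.norm_sq_eq_of_L2, Finset.sum_mul]
  simp [rmul, mul_pow]

lemma rmul_rmul (x : Vec K m) (α β : K) : rmul (rmul x α) β = rmul x (α * β) := by
  ext i
  simp [rmul, mul_assoc]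

lemma rmul_one (x : Vec K m) : rmul x 1 = x := by
  ext i
  simp [rmul]

lemma eq_one_of_rmul_eq_self {x : Vec K m} (hx : x ≠ 0) {α : K} (h : x = rmul x α) : α = 1 := by
  obtain ⟨i, hi⟩ : ∃ i, x i ≠ 0 := by
    by_contra! h0
    exact hx (by ext i; simpa using h0 i)
  have h1 : x i = x i * α := congrArg (fun y : Vec K m => y i) h
  exact (mul_right_eq_self₀.1 h1.symm).resolve_right hi

variable [InnerProductSpace ℝ K] [FiniteDimensional ℝ K] [IsScalarTower ℝ K K]

omit [FiniteDimensional ℝ K] in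
lemma rmul_smul (t : ℝ) (x : Vec K m) (α : K) : rmul (t • x) α = t • rmul x α := by
  ext i
  exact smul_mul_assoc t (x i) α

/-- The map `α ↦ x α` as a real linear map. -/
def rmulLinear [SMulCommClass ℝ K K] (x : Vec K m) : K →ₗ[ℝ] Vec K m where
  toFun α := rmul x α
  map_add' α β := by ext i; simp [rmul, mul_add]
  map_smul' t α := by ext i; exact mul_smul_comm t (x i) α

/-- The right multiplication by a scalar of norm one as a real linear isometry of `K`. -/
def mulRightIsometry (α : K) (hα : ‖α‖ = 1) : K ≃ₗᵢ[ℝ] K :=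
  LinearIsometry.toLinearIsometryEquiv
    { toFun := fun x => x * α
      map_add' := fun x y => add_mul x y α
      map_smul' := fun t x => smul_mul_assoc t x α
      norm_map' := fun x => by simp [hα] } rfl

lemma mulRightIsometry_apply (α : K) (hα : ‖α‖ = 1) (x : K) :
    mulRightIsometry α hα x = x * α := rfl

variable (K m) in
omit [IsScalarTower ℝ K K] in
/-- The decomposition `K^(m+1) = K × K^m`. -/
def splitVec : Vec K (m + 1) ≃L[ℝ] K × Vec K m :=
  LinearEquiv.toContinuousLinearEquiv
    { toFun := fun x => (x 0, WithLp.toLp 2 fun i => x i.succ)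
      invFun := fun z => WithLp.toLp 2 (Fin.cons (α := fun _ => K) z.1 z.2.ofLp)
      map_add' := fun x y => rfl
      map_smul' := fun t x => rfl
      left_inv := fun x => by
        ext i
        refine Fin.cases ?_ (fun j => ?_) i <;> simp
      right_inv := fun z => by
        ext <;> simp }

omit [IsScalarTower ℝ K K] in
lemma norm_sq_eq_split (x : Vec K (m + 1)) :
    ‖x‖ ^ 2 = ‖(splitVec K m x).1‖ ^ 2 + ‖(splitVec K m x).2‖ ^ 2 := by
  rw [PiLp.norm_sq_eq_of_L2, PiLp.norm_sq_eq_of_L2, Fin.sum_univ_succ]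
  rfl

omit [IsScalarTower ℝ K K] in
lemma splitVec_rmul (x : Vec K (m + 1)) (α : K) :
    splitVec K m (rmul x α) = ((splitVec K m x).1 * α, rmul (splitVec K m x).2 α) := rfl

omit [IsScalarTower ℝ K K] in
lemma splitVec_symm_rmul (ξ : K) (y : Vec K m) (α : K) :
    rmul ((splitVec K m).symm (ξ, y)) α = (splitVec K m).symm (ξ * α, rmul y α) := by
  apply (splitVec K m).injective
  rw [splitVec_rmul]
  simp

end Vec

/-! ### Bihomogeneous components and reduction to radial moments -/

section Step

variable {K : Type} [NormedDivisionRing K] [InnerProductSpace ℝ K] [FiniteDimensional ℝ K]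
  {m p n : ℕ}

lemma mem_Phi_iff {φ : Vec K m → ℂ} : φ ∈ Phi K m p ↔ φ ∈ homPoly (Vec K m) p ∧
    ∀ (x : Vec K m) (α : K), ‖α‖ = 1 → φ (rmul x α) = φ x := by
  rw [← isHomogeneousPolynomial_iff_mem_homPoly]
  rfl

lemma norm_pow_mem_Phi (hp : Even p) : (fun x : Vec K m => ((‖x‖ ^ p : ℝ) : ℂ)) ∈ Phi K m p :=
  mem_Phi_iff.2 ⟨norm_pow_mem_homPoly hp, fun x α hα => by rw [norm_rmul, hα, mul_one]⟩

/-- The bihomogeneous components of an invariant polynomial on `K × K^m`. -/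
structure InvariantDecomposition (m p : ℕ) (φ : Vec K (m + 1) → ℂ) where
  /-- the component of bidegree `(j, p - j)` -/
  comp : ℕ → K → Vec K m → ℂ
  eq_sum : ∀ ξ y, φ ((splitVec K m).symm (ξ, y)) = ∑ j ∈ Finset.range (p + 1), comp j ξ y
  left_mem : ∀ j y, (fun ξ => comp j ξ y) ∈ homPoly K j
  right_mem : ∀ j ≤ p, ∀ ξ, comp j ξ ∈ homPoly (Vec K m) (p - j)
  invariant : ∀ j ≤ p, ∀ ξ y (α : K), ‖α‖ = 1 → comp j (ξ * α) (rmul y α) = comp j ξ y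

/-- Scaling `ξ` by a real `t` separates the components by powers of `t`, and real scalars commute
with right multiplication; hence invariance of the sum passes to each component. -/
lemma exists_invariantDecomposition [IsScalarTower ℝ K K] {φ : Vec K (m + 1) → ℂ}
    (hφ : φ ∈ Phi K (m + 1) p) : Nonempty (InvariantDecomposition m p φ) := by
  rw [mem_Phi_iff] at hφ
  obtain ⟨F, hF, hF1, hF2⟩ := exists_bihomogeneous
    (comp_mem_homPoly hφ.1 (splitVec K m).symm.toLinearEquiv.toLinearMap)
  replace hF : ∀ ξ y, φ ((splitVec K m).symm (ξ, y)) = ∑ j ∈ Finset.range (p + 1), F j ξ y := hF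
  refine ⟨F, hF, hF1, hF2, fun j hj ξ y α hα => ?_⟩
  have h := mem_of_forall_sum_pow_smul_mem (⊥ : Submodule ℂ ℂ) (p + 1)
    (fun j => F j (ξ * α) (rmul y α) - F j ξ y) (fun t => ?_) (k := j) (by omega)
  · exact sub_eq_zero.1 h
  · have h1 : ∀ j, (t : ℂ) ^ j • (F j (ξ * α) (rmul y α) - F j ξ y) =
        F j ((t • ξ) * α) (rmul y α) - F j (t • ξ) y := by
      intro j
      rw [smul_mul_assoc, homPoly_map_smul (hF1 j _), homPoly_map_smul (hF1 j _), smul_eq_mul,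
        mul_sub]
    simp only [h1]
    rw [Finset.sum_sub_distrib, ← hF, ← hF, ← splitVec_symm_rmul, hφ.2 _ _ hα, sub_self]
    exact zero_mem _

variable [MeasurableSpace K] [BorelSpace K]

/-- The spherical design of `exists_design` integrates every even component over the sphere
of `K`. -/
lemma InvariantDecomposition.integral_comp [SMulCommClass ℝ K K] {φ : Vec K (m + 1) → ℂ}
    (D : InvariantDecomposition m p φ) (hp : Even p)
    (hconj : ∃ c : K →ₗ[ℝ] K, ∀ u, ‖u‖ = 1 → c u = u⁻¹) {ι : Type} [Fintype ι] {u : ι → K}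
    {lam : ι → ℝ} (hu : ∀ l, ‖u l‖ = 1)
    (hdes : ∀ j ≤ 2 * (p / 4), Even j → ∀ f ∈ homPoly K j,
      ∫ x : Metric.sphere (0 : K) 1, f x ∂(unitSphereMeasure K) = ∑ l, (lam l : ℂ) * f (u l))
    {j : ℕ} (hj : Even j) (hjp : j ≤ p) (y : Vec K m) :
    ∫ x : Metric.sphere (0 : K) 1, D.comp j x y ∂(unitSphereMeasure K) =
      ∑ l, (lam l : ℂ) * D.comp j (u l) y := by
  by_cases hj4 : j ≤ 2 * (p / 4)
  · exact hdes j hj4 hj _ (D.left_mem j y)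
  · obtain ⟨c, hc⟩ := hconj
    have hg := comp_mem_homPoly (D.right_mem j hjp 1) ((rmulLinear y).comp c)
    -- Multiplying both arguments by `v⁻¹` moves `v` to the second argument, where it enters through
    -- the linear map `c`. The degree in `v` drops from `j` to `p - j`.
    have heq : ∀ v : K, ‖v‖ = 1 → D.comp j v y = D.comp j 1 (((rmulLinear y).comp c) v) := by
      intro v hv
      have hv0 : v ≠ 0 := norm_ne_zero_iff.1 (by rw [hv]; exact one_ne_zero)
      rw [← D.invariant j hjp v y v⁻¹ (by rw [norm_inv, hv, inv_one]), mul_inv_cancel₀ hv0]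
      simp only [LinearMap.comp_apply, hc v hv]
      rfl
    have h1 := hdes (p - j) (by obtain ⟨a, rfl⟩ := hp; obtain ⟨b, rfl⟩ := hj; omega)
      (by rw [Nat.even_sub hjp]; tauto) _ hg
    simp only [heq _ (hu _)]
    rw [← h1]
    exact integral_congr_ae (.of_forall fun v => heq v (norm_eq_of_mem_sphere v))

variable [SecondCountableTopology K]

/-- A projective cubature formula integrates the invariant polynomials of smaller even degree. -/
lemma ProjectiveCubature.gaussIntegral_eq [Nontrivial (Vec K m)] (C : ProjectiveCubature K m p n)
    {j : ℕ} (hj : Even j) (hjp : j ≤ p) {ψ : Vec K m → ℂ} (hψ : ψ ∈ Phi K m (p - j)) :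
    gaussIntegral ψ = gaussMoment (Vec K m) (p - j) * ∑ k, (C.weight k : ℂ) * ψ (C.node k) := by
  rw [mem_Phi_iff] at hψ
  have h1 : ψ * (fun x => ((‖x‖ ^ j : ℝ) : ℂ)) ∈ Phi K m p := by
    rw [mem_Phi_iff]
    refine ⟨?_, fun x α hα => ?_⟩
    · have := mul_mem_homPoly hψ.1 (norm_pow_mem_homPoly (E := Vec K m) hj)
      rwa [Nat.sub_add_cancel hjp] at this
    · simp only [Pi.mul_apply, hψ.2 x α hα, norm_rmul, hα, mul_one]
  rw [gaussIntegral_eq_sphere hψ.1]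
  congr 1
  have h2 := C.integral_eq _ h1
  simp only [Pi.mul_apply, C.norm_node, norm_eq_of_mem_sphere, one_pow, Complex.ofReal_one,
    mul_one] at h2
  exact h2.trans (Finset.sum_congr rfl fun k _ => mul_comm _ _)

variable [IsScalarTower ℝ K K] [SMulCommClass ℝ K K]

/-- The moments of the radial part of the uniform distribution on the sphere of `K × V`, up to
a factor. -/
def radialMoment (E F : Type) [NormedAddCommGroup E] [InnerProductSpace ℝ E]
    [FiniteDimensional ℝ E] [MeasurableSpace E] [BorelSpace E] [NormedAddCommGroup F]
    [InnerProductSpace ℝ F] [FiniteDimensional ℝ F] [MeasurableSpace F] [BorelSpace F]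
    (κ : ℝ) (p j : ℕ) : ℝ :=
  if Even j then κ * (gaussMoment E j * gaussMoment F (p - j)) else 0

variable (K m p) in
/-- The integral of an invariant polynomial over the sphere of `K^(m+1)` in terms of its
bihomogeneous components. -/
lemma exists_integral_eq_sum_radialMoment [Nontrivial (Vec K m)] (hp : Even p)
    (hconj : ∃ c : K →ₗ[ℝ] K, ∀ u, ‖u‖ = 1 → c u = u⁻¹) {ι : Type} [Fintype ι] {u : ι → K}
    {lam : ι → ℝ} (hu : ∀ l, ‖u l‖ = 1)
    (hdes : ∀ j ≤ 2 * (p / 4), Even j → ∀ f ∈ homPoly K j,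
      ∫ x : Metric.sphere (0 : K) 1, f x ∂(unitSphereMeasure K) = ∑ l, (lam l : ℂ) * f (u l))
    (C : ProjectiveCubature K m p n) :
    ∃ κ : ℝ, 0 < κ ∧ ∀ φ ∈ Phi K (m + 1) p, ∀ D : InvariantDecomposition m p φ,
      ∫ x : Metric.sphere (0 : Vec K (m + 1)) 1, φ x ∂(sphereMeasure K (m + 1)) =
        ∑ j ∈ Finset.range (p + 1), (radialMoment K (Vec K m) κ p j : ℂ) *
          ∑ a : ι × Fin n, ((lam a.1 * C.weight a.2 : ℝ) : ℂ) *
            D.comp j (u a.1) (C.node a.2) := by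
  obtain ⟨c, hc, hprod⟩ := exists_gaussIntegral_prod (splitVec K m) norm_sq_eq_split
  have hG := gaussMoment_pos (E := Vec K (m + 1)) p
  have hGc : (gaussMoment (Vec K (m + 1)) p : ℂ) ≠ 0 := by exact_mod_cast hG.ne'
  refine ⟨c / gaussMoment (Vec K (m + 1)) p, by positivity, fun φ hφ D => ?_⟩
  have hφ' := mem_Phi_iff.1 hφ
  have hinner : ∀ y : Vec K m, gaussIntegral (fun ξ => φ ((splitVec K m).symm (ξ, y))) =
      ∑ j ∈ Finset.range (p + 1), (if Even j then (gaussMoment K j : ℂ) else 0) *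
        ∑ l, (lam l : ℂ) * D.comp j (u l) y := by
    intro y
    have h1 : gaussIntegral (fun ξ => φ ((splitVec K m).symm (ξ, y))) =
        ∑ j ∈ Finset.range (p + 1), gaussIntegral (fun ξ => D.comp j ξ y) := by
      simp only [gaussIntegral, D.eq_sum, Finset.sum_mul]
      exact integral_finsetSum _ fun j _ => integrable_gauss_of_mem_homPoly (D.left_mem j y)
    rw [h1]
    refine Finset.sum_congr rfl fun j hj => ?_
    split_ifs with he
    · rw [gaussIntegral_eq_sphere (D.left_mem j y), D.integral_comp hp hconj hu hdes he
        (Finset.mem_range_succ_iff.1 hj)]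
    · rw [gaussIntegral_eq_zero_of_odd (Nat.not_even_iff_odd.1 he) (D.left_mem j y), zero_mul]
  have hψ : ∀ j ≤ p, ∀ l, D.comp j (u l) ∈ homPoly (Vec K m) (p - j) :=
    fun j hj l => D.right_mem j hj (u l)
  have hψsum : ∀ j ≤ p, (fun y => ∑ l, (lam l : ℂ) * D.comp j (u l) y) ∈
      homPoly (Vec K m) (p - j) := by
    intro j hj
    have := Submodule.sum_mem (homPoly (Vec K m) (p - j)) (t := Finset.univ)
      (f := fun l => (lam l : ℂ) • D.comp j (u l))
      fun l _ => Submodule.smul_mem _ (lam l : ℂ) (hψ j hj l)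
    convert this using 1
    ext y
    simp
  have houter : ∀ j ≤ p, Even j → gaussIntegral (fun y => ∑ l, (lam l : ℂ) * D.comp j (u l) y) =
      gaussMoment (Vec K m) (p - j) * ∑ a : ι × Fin n, ((lam a.1 * C.weight a.2 : ℝ) : ℂ) *
            D.comp j (u a.1) (C.node a.2) := by
    intro j hj he
    rw [C.gaussIntegral_eq he hj (mem_Phi_iff.2 ⟨hψsum j hj, fun y α hα => ?_⟩)]
    · rw [Fintype.sum_prod_type_right]
      congr 1
      refine Finset.sum_congr rfl fun k _ => ?_
      rw [Finset.mul_sum]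
      refine Finset.sum_congr rfl fun l _ => ?_
      push_cast
      ring
    · have hα0 : α ≠ 0 := norm_ne_zero_iff.1 (by rw [hα]; exact one_ne_zero)
      have hα' : ‖α⁻¹‖ = 1 := by rw [norm_inv, hα, inv_one]
      have hGj : (gaussMoment K j : ℂ) ≠ 0 := by exact_mod_cast (gaussMoment_pos (E := K) j).ne'
      -- The design itself is not invariant, but its sum equals the integral over the whole sphere
      -- of `K`, and right multiplication by `α⁻¹` preserves the Gaussian integral.
      rw [← D.integral_comp hp hconj hu hdes he hj, ← D.integral_comp hp hconj hu hdes he hj,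
        ← mul_right_inj' hGj, ← gaussIntegral_eq_sphere (D.left_mem j _),
        ← gaussIntegral_eq_sphere (D.left_mem j _),
        ← gaussIntegral_comp_isometry (fun ξ => D.comp j ξ y) (mulRightIsometry α⁻¹ hα')]
      congr 1
      ext ξ
      rw [mulRightIsometry_apply, ← D.invariant j hj ξ (rmul y α) α⁻¹ hα', rmul_rmul,
        mul_inv_cancel₀ hα0, rmul_one]
  have htotal : gaussIntegral φ = c * ∑ j ∈ Finset.range (p + 1),
      (if Even j then (gaussMoment K j : ℂ) else 0) * (gaussMoment (Vec K m) (p - j) *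
        ∑ a : ι × Fin n, ((lam a.1 * C.weight a.2 : ℝ) : ℂ) *
            D.comp j (u a.1) (C.node a.2)) := by
    have h1 := hprod p _ (comp_mem_homPoly hφ'.1 (splitVec K m).symm.toLinearEquiv.toLinearMap)
    have h2 : (fun x => φ ((splitVec K m).symm.toLinearEquiv.toLinearMap (splitVec K m x))) =
        φ := by
      ext x
      exact congrArg φ ((splitVec K m).symm_apply_apply x)
    rw [h2] at h1
    rw [h1]
    congr 1
    have h3 : (fun y => gaussIntegral fun ξ =>
        φ ((splitVec K m).symm.toLinearEquiv.toLinearMap (ξ, y))) = fun y =>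
        ∑ j ∈ Finset.range (p + 1), (if Even j then (gaussMoment K j : ℂ) else 0) *
          ∑ l, (lam l : ℂ) * D.comp j (u l) y := funext hinner
    rw [h3]
    have hsw : gaussIntegral (fun y => ∑ j ∈ Finset.range (p + 1),
        (if Even j then (gaussMoment K j : ℂ) else 0) * ∑ l, (lam l : ℂ) * D.comp j (u l) y) =
        ∑ j ∈ Finset.range (p + 1), (if Even j then (gaussMoment K j : ℂ) else 0) *
          gaussIntegral (fun y => ∑ l, (lam l : ℂ) * D.comp j (u l) y) := by
      simp only [gaussIntegral, Finset.sum_mul (Finset.range (p + 1)), mul_assoc,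
        ← integral_const_mul]
      exact integral_finsetSum _ fun j hj => (integrable_gauss_of_mem_homPoly
        (hψsum j (Finset.mem_range_succ_iff.1 hj))).const_mul _
    rw [hsw]
    refine Finset.sum_congr rfl fun j hj => ?_
    split_ifs with he
    · rw [houter j (Finset.mem_range_succ_iff.1 hj) he]
    · simp
  have hsphere := gaussIntegral_eq_sphere hφ'.1
  rw [htotal] at hsphere
  change ∫ x : Metric.sphere (0 : Vec K (m + 1)) 1, φ x ∂(unitSphereMeasure (Vec K (m + 1))) = _
  rw [← mul_right_inj' hGc, ← hsphere, Finset.mul_sum, Finset.mul_sum]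
  refine Finset.sum_congr rfl fun j _ => ?_
  rw [radialMoment]
  split_ifs
  · push_cast
    field_simp
  · simp

end Step

/-! ### Positive definiteness of the radial moments -/

section Positivity

open Polynomial

/-- The homogenization `∑ f_j s^j r^(k-j)` of a real polynomial is multiplicative. -/
lemma sum_coeff_mul_self (f : ℝ[X]) {q : ℕ} (hf : f.natDegree ≤ q) (s r : ℝ) :
    ∑ j ∈ Finset.range (2 * q + 1), (f * f).coeff j * s ^ j * r ^ (2 * q - j) =
      (∑ j ∈ Finset.range (q + 1), f.coeff j * s ^ j * r ^ (q - j)) ^ 2 := by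
  have key : ∀ (g : ℝ[X]) (k : ℕ), g.natDegree ≤ k →
      ∑ j ∈ Finset.range (k + 1), g.coeff j * s ^ j * r ^ (k - j) =
        MvPolynomial.eval ![s, r] (g.homogenize k) := by
    intro g k hg
    conv_rhs => rw [g.as_sum_range' (k + 1) (Nat.lt_succ_of_le hg), homogenize_finsetSum, map_sum]
    refine Finset.sum_congr rfl fun j hj => ?_
    rw [homogenize_monomial (Finset.mem_range_succ_iff.1 hj), MvPolynomial.eval_monomial,
      Finsupp.prod_fintype _ _ (by simp)]
    simp [mul_assoc]
  rw [key _ _ hf, key _ _ (natDegree_mul_le.trans (by omega)), two_mul, homogenize_mul f f hf hf,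
    map_mul, sq]

variable {E F : Type} [NormedAddCommGroup E] [InnerProductSpace ℝ E] [FiniteDimensional ℝ E]
  [MeasurableSpace E] [BorelSpace E] [NormedAddCommGroup F] [InnerProductSpace ℝ F]
  [FiniteDimensional ℝ F] [MeasurableSpace F] [BorelSpace F] [Nontrivial E] [Nontrivial F]

/-- The functional on `f * f` is `κ` times a Gaussian integral of the squared homogenization of `f`
at `(± ‖x‖, ‖y‖)`, averaged over the sign. The average removes the odd coefficients, in agreement
with the vanishing odd moments. -/
lemma posDefUpTo_radialMoment {κ : ℝ} (hκ : 0 < κ) (q : ℕ) :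
    PosDefUpTo (momentFunctional (radialMoment E F κ (2 * q))) q := by
  intro f hf0 hf
  let H : ℝ → ℝ → ℝ := fun s r => ∑ j ∈ Finset.range (q + 1), f.coeff j * s ^ j * r ^ (q - j)
  have hH : Continuous fun z : ℝ × ℝ => H z.1 z.2 := by fun_prop
  have hHc : ∀ {X : Type} [TopologicalSpace X] (a b : X → ℝ), Continuous a → Continuous b →
      Continuous fun x => H (a x) (b x) := fun a b ha hb => hH.comp (ha.prodMk hb)
  set W : E × F → ℝ := fun z => Real.exp (-‖z.1‖ ^ 2) * Real.exp (-‖z.2‖ ^ 2) with hW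
  set I : E × F → ℝ := fun z =>
    (H ‖z.1‖ ‖z.2‖ ^ 2 + H (-‖z.1‖) ‖z.2‖ ^ 2) / 2 * W z with hI
  have hterm : ∀ j k, Integrable (fun z : E × F => (‖z.1‖ ^ j * Real.exp (-‖z.1‖ ^ 2)) *
      (‖z.2‖ ^ k * Real.exp (-‖z.2‖ ^ 2))) ((volume : Measure E).prod (volume : Measure F)) :=
    fun j k => (integrable_norm_pow_gauss j).mul_prod (integrable_norm_pow_gauss k)
  have hIsum : I = fun z => ∑ j ∈ Finset.range (2 * q + 1),
      (if Even j then (f * f).coeff j else 0) * ((‖z.1‖ ^ j * Real.exp (-‖z.1‖ ^ 2)) *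
      (‖z.2‖ ^ (2 * q - j) * Real.exp (-‖z.2‖ ^ 2))) := by
    ext z
    simp only [hI, H, hW, ← sum_coeff_mul_self f hf]
    rw [← Finset.sum_add_distrib, Finset.sum_div, Finset.sum_mul]
    refine Finset.sum_congr rfl fun j _ => ?_
    split_ifs with he
    · rw [he.neg_pow]; ring
    · rw [(Nat.not_even_iff_odd.1 he).neg_pow]; ring
  have hIint : Integrable I ((volume : Measure E).prod (volume : Measure F)) := by
    rw [hIsum]
    exact integrable_finsetSum _ fun j _ => (hterm _ _).const_mul _
  have heq : momentFunctional (radialMoment E F κ (2 * q)) (f * f) =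
      κ * ∫ z, I z ∂((volume : Measure E).prod (volume : Measure F)) := by
    rw [momentFunctional_eq_sum _ (k := 2 * q + 1) (lt_of_le_of_lt natDegree_mul_le (by omega)),
      hIsum, integral_finsetSum _ fun j _ => (hterm _ _).const_mul _, Finset.mul_sum]
    refine Finset.sum_congr rfl fun j _ => ?_
    rw [integral_const_mul, integral_prod_mul (fun x : E => ‖x‖ ^ j * Real.exp (-‖x‖ ^ 2))
      (fun y : F => ‖y‖ ^ (2 * q - j) * Real.exp (-‖y‖ ^ 2)), radialMoment]
    split_ifs
    · simp only [gaussMoment]; ring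
    · ring
  rw [heq]
  refine mul_pos hκ ?_
  -- At norms `s` and `1` the homogenization takes the value `f.eval s`, so the integrand is
  -- positive somewhere.
  obtain ⟨s, hs, hfs⟩ : ∃ s : ℝ, 0 < s ∧ f.eval s ≠ 0 := by
    by_contra! h
    exact hf0 (eq_zero_of_infinite_isRoot f ((Set.Ioi_infinite (0 : ℝ)).mono fun s hs => h s hs))
  obtain ⟨e, he⟩ := exists_norm_eq E hs.le
  obtain ⟨e', he'⟩ := exists_norm_eq F zero_le_one
  refine integral_pos_of_integrable_nonneg_nonzero (x := (e, e')) ?_ hIint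
    (fun z => by simp only [hI, hW, Pi.zero_apply]; positivity) ?_
  · have h1 := hHc (fun z : E × F => ‖z.1‖) (fun z => ‖z.2‖) (by fun_prop) (by fun_prop)
    have h2 := hHc (fun z : E × F => -‖z.1‖) (fun z => ‖z.2‖) (by fun_prop) (by fun_prop)
    simp only [hI, hW]
    fun_prop
  · have h1 : H s 1 = f.eval s := by
      simp only [H, one_pow, mul_one]
      rw [eval_eq_sum_range' (Nat.lt_succ_of_le hf)]
    have h2 : 0 < f.eval s ^ 2 := by positivity
    simp only [hI, hW, he, he', h1]
    positivity

end Positivity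

/-! ### Nodes of finite and infinite slope -/

section Nodes

variable {K : Type} [NormedDivisionRing K] [InnerProductSpace ℝ K] [FiniteDimensional ℝ K]
  {m p : ℕ}

lemma norm_splitVec_symm (ξ : K) (y : Vec K m) :
    ‖(splitVec K m).symm (ξ, y)‖ ^ 2 = ‖ξ‖ ^ 2 + ‖y‖ ^ 2 := by
  rw [norm_sq_eq_split, ContinuousLinearEquiv.apply_symm_apply]

/-- The node of the sphere of `K^(m+1)` over a pair of points of the spheres of `K` and `K^m` with
slope `z`. -/
def slopeNode (z : ℝ) (u : K) (y : Vec K m) : Vec K (m + 1) :=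
  (splitVec K m).symm (((√(1 + z ^ 2))⁻¹ * z) • u, (√(1 + z ^ 2))⁻¹ • y)

lemma norm_slopeNode (z : ℝ) {u : K} {y : Vec K m} (hu : ‖u‖ = 1) (hy : ‖y‖ = 1) :
    ‖slopeNode z u y‖ = 1 := by
  have h : (0 : ℝ) < 1 + z ^ 2 := by positivity
  rw [← sq_eq_sq₀ (norm_nonneg _) zero_le_one, slopeNode, norm_splitVec_symm, norm_smul, norm_smul,
    hu, hy, mul_one, mul_one, Real.norm_eq_abs, Real.norm_eq_abs, sq_abs, sq_abs, mul_pow, inv_pow,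
    Real.sq_sqrt h.le]
  field_simp
  ring

lemma slopeNode_eq_rmul [IsScalarTower ℝ K K] {z z' : ℝ} {u u' : K} {y y' : Vec K m}
    (hy : ‖y‖ = 1) (hy' : ‖y'‖ = 1)
    {α : K} (hα : ‖α‖ = 1) (h : slopeNode z u y = rmul (slopeNode z' u' y') α) :
    z • u = (z' • u') * α ∧ y = rmul y' α := by
  have hpos : ∀ t : ℝ, (0 : ℝ) < (√(1 + t ^ 2))⁻¹ := fun t =>
    inv_pos.2 (Real.sqrt_pos.2 (by positivity))
  rw [slopeNode, slopeNode, splitVec_symm_rmul] at h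
  have h1 := (splitVec K m).symm.injective h
  rw [Prod.mk.injEq, rmul_smul] at h1
  have h2 : (√(1 + z ^ 2))⁻¹ = (√(1 + z' ^ 2))⁻¹ := by
    have := congrArg norm h1.2
    rwa [norm_smul, norm_smul, norm_rmul, hy, hy', hα, mul_one, mul_one, mul_one,
      Real.norm_of_nonneg (hpos _).le, Real.norm_of_nonneg (hpos _).le] at this
  rw [h2, mul_smul, mul_smul, smul_mul_assoc] at h1
  exact ⟨smul_right_injective _ (hpos z').ne' h1.1, smul_right_injective _ (hpos z').ne' h1.2⟩

/-- Normalizing the node divides `φ` by `(1 + z ^ 2) ^ q`; the cubature weights carry this factor to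
compensate, leaving a polynomial in the slope. -/
lemma InvariantDecomposition.slopeNode_eq {φ : Vec K (m + 1) → ℂ} (hφ : φ ∈ Phi K (m + 1) p)
    {q : ℕ} (hpq : p = 2 * q) (D : InvariantDecomposition m p φ) (z : ℝ) (u : K) (y : Vec K m) :
    φ (slopeNode z u y) * (((1 + z ^ 2) ^ q : ℝ) : ℂ) =
      ∑ j ∈ Finset.range (p + 1), ((z ^ j : ℝ) : ℂ) * D.comp j u y := by
  have h : (0 : ℝ) < 1 + z ^ 2 := by positivity
  have h1 : slopeNode z u y = (√(1 + z ^ 2))⁻¹ • (splitVec K m).symm (z • u, y) := by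
    rw [slopeNode, ← map_smul, Prod.smul_mk, smul_smul]
  have h2 : ((√(1 + z ^ 2))⁻¹) ^ p * (1 + z ^ 2) ^ q = 1 := by
    rw [hpq, inv_pow, pow_mul, Real.sq_sqrt h.le]
    exact inv_mul_cancel₀ (by positivity)
  rw [h1, homPoly_map_smul (mem_Phi_iff.1 hφ).1, D.eq_sum, mul_right_comm,
    ← Complex.ofReal_pow, ← Complex.ofReal_mul, h2, Complex.ofReal_one, one_mul]
  refine Finset.sum_congr rfl fun j _ => ?_
  rw [homPoly_map_smul (D.left_mem j y), Complex.ofReal_pow]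

/-- The component of bidegree `(p, 0)` does not depend on `y`, and by invariance not on the unit
`u`. The other components have positive degree in `y` and vanish at `y = 0`. This is why all masses
at infinity merge into one node. -/
lemma InvariantDecomposition.axis_eq {φ : Vec K (m + 1) → ℂ} (D : InvariantDecomposition m p φ)
    {u : K} (hu : ‖u‖ = 1) (y : Vec K m) :
    φ ((splitVec K m).symm (1, 0)) = D.comp p u y := by
  have hu0 : u ≠ 0 := norm_ne_zero_iff.1 (by rw [hu]; exact one_ne_zero)
  rw [D.eq_sum, Finset.sum_range_succ, Finset.sum_eq_zero, zero_add]
  · have h1 : ∀ y, D.comp p u y = D.comp p u 0 := by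
      intro y
      have := homPoly_map_smul (D.right_mem p le_rfl u) 0 y
      simpa using this.symm
    rw [h1, ← D.invariant p le_rfl 1 0 u hu, one_mul]
    congr 1
    ext i
    simp [rmul]
  · intro j hj
    have hj := Finset.mem_range.1 hj
    have := homPoly_map_smul (D.right_mem j hj.le 1) 0 0
    simpa [Nat.sub_ne_zero_of_lt hj] using this

end Nodes

/-! ### Cubature formulas over a finite index type -/

section Assembly

variable {K : Type} [NormedDivisionRing K] [InnerProductSpace ℝ K] [FiniteDimensional ℝ K]
  [MeasurableSpace K] [BorelSpace K] [SecondCountableTopology K] {m p n : ℕ}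

lemma ProjectiveCubature.pos (C : ProjectiveCubature K m p n) : 0 < n := by
  rcases Nat.eq_zero_or_pos n with rfl | h
  · simpa using C.sum_weight
  · exact h

/-- A projective cubature formula from nodes indexed by a finite type. The weights have sum one
automatically. -/
lemma nonempty_projectiveCubature [Nontrivial (Vec K m)] (hp : Even p) {ι : Type} [Fintype ι]
    (x : ι → Vec K m) (w : ι → ℝ) (hx : ∀ i, ‖x i‖ = 1)
    (hdist : ∀ i k, i ≠ k → ∀ α : K, ‖α‖ = 1 → x i ≠ rmul (x k) α) (hw : ∀ i, 0 < w i)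
    (hex : ∀ φ ∈ Phi K m p, ∫ x : Metric.sphere (0 : Vec K m) 1, φ x ∂(sphereMeasure K m)
      = ∑ i, φ (x i) * (w i : ℂ)) :
    Nonempty (ProjectiveCubature K m p (Fintype.card ι)) := by
  have hsum : ∑ i, w i = 1 := by
    -- Testing with `‖x‖ ^ p` shows that the weights sum to one, so no constant such as `κ` has to
    -- be computed.
    have h := hex _ (norm_pow_mem_Phi hp)
    change ∫ y : Metric.sphere (0 : Vec K m) 1, _ ∂(unitSphereMeasure (Vec K m)) = _ at h
    simp only [norm_eq_of_mem_sphere, hx, one_pow, Complex.ofReal_one, integral_const,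
      probReal_univ, one_smul, one_mul] at h
    exact_mod_cast h.symm
  let e := (Fintype.equivFin ι).symm
  exact ⟨{
    node := fun k => x (e k)
    weight := fun k => w (e k)
    norm_node := fun k => hx _
    node_distinct := fun i k hik => hdist _ _ fun h => hik (e.injective h)
    weight_pos := fun k => hw _
    sum_weight := by rw [← hsum]; exact e.sum_comp w
    integral_eq := fun φ hφ => by
      rw [hex φ hφ]; exact (e.sum_comp fun i => φ (x i) * (w i : ℂ)).symm }⟩

end Assembly

/-! ### The recursive construction and the count of nodes -/

section Recursion

variable {K : Type} [NormedDivisionRing K] [InnerProductSpace ℝ K] [FiniteDimensional ℝ K]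
  [MeasurableSpace K] [BorelSpace K] [SecondCountableTopology K] {m p n : ℕ}
  [IsScalarTower ℝ K K]

/-- The recursive construction: a point `u l` of the sphere of `K`, a point `y k` of the sphere of
`K^m`, and the nodes `z (l, k) i` of a quadrature of the radial moments, possibly with a mass
`b (l, k)` at infinity, make up a cubature formula on the sphere of `K^(m+1)`. The masses at
infinity are gathered in one node. -/
lemma nonempty_of_quadratures {q : ℕ} (hpq : p = 2 * q) {ν e : ℕ} {u : Fin ν → K}
    {y : Fin n → Vec K m} {c : Fin ν × Fin n → ℝ} {M : ℕ → ℝ}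
    (hu : ∀ l, ‖u l‖ = 1) (hup : ∀ l l', l ≠ l' → ∀ t : ℝ, u l ≠ t • u l')
    (hy : ∀ k, ‖y k‖ = 1) (hyp : ∀ i k, i ≠ k → ∀ α : K, ‖α‖ = 1 → y i ≠ rmul (y k) α)
    (hc : ∀ a, 0 < c a)
    (hM : ∀ φ ∈ Phi K (m + 1) p, ∀ D : InvariantDecomposition m p φ,
      ∫ x : Metric.sphere (0 : Vec K (m + 1)) 1, φ x ∂(sphereMeasure K (m + 1)) =
        ∑ j ∈ Finset.range (p + 1), (M j : ℂ) *
          ∑ a : Fin ν × Fin n, (c a : ℂ) * D.comp j (u a.1) (y a.2))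
    (N : Fin ν × Fin n → ℕ) (z w : ∀ a, Fin (N a) → ℝ) (b : Fin ν × Fin n → ℝ)
    (hz : ∀ a, Function.Injective (z a)) (hz0 : ∀ a i, z a i ≠ 0) (hw : ∀ a i, 0 < w a i)
    (hzw : ∀ a, ∀ j ≤ 2 * q, M j = ∑ i, w a i * z a i ^ j + if j = 2 * q then b a else 0)
    (he : (e = 0 ∧ ∀ a, b a = 0) ∨ (e = 1 ∧ 0 < ∑ a, c a * b a)) :
    Nonempty (ProjectiveCubature K (m + 1) p (∑ a, N a + e)) := by
  have : Nontrivial (Vec K (m + 1)) := (splitVec K m).toEquiv.nontrivial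
  have hcard : Fintype.card ((Σ a, Fin (N a)) ⊕ Fin e) = ∑ a, N a + e := by simp
  rw [← hcard]
  set B := ∑ a, c a * b a with hB
  have hone : ‖(splitVec K m).symm (1, 0)‖ = 1 := by
    rw [← sq_eq_sq₀ (norm_nonneg _) zero_le_one, norm_splitVec_symm]
    simp
  have hpos : ∀ t : ℝ, (0 : ℝ) < (√(1 + t ^ 2))⁻¹ := fun t =>
    inv_pos.2 (Real.sqrt_pos.2 (by positivity))
  have hne : ∀ k, y k ≠ 0 := fun k => norm_ne_zero_iff.1 (by rw [hy]; exact one_ne_zero)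
  refine nonempty_projectiveCubature (by rw [hpq]; exact even_two_mul q)
    (Sum.elim (fun s => slopeNode (z s.1 s.2) (u s.1.1) (y s.1.2))
      fun _ => (splitVec K m).symm (1, 0))
    (Sum.elim (fun s => c s.1 * w s.1 s.2 * (1 + z s.1 s.2 ^ 2) ^ q) fun _ => B) ?_ ?_ ?_ ?_
  · rintro (s | i)
    · exact norm_slopeNode _ (hu _) (hy _)
    · exact hone
  · rintro (⟨⟨l, k⟩, i⟩ | i) (⟨⟨l', k'⟩, i'⟩ | i') hik α hα h
    · obtain ⟨h1, h2⟩ := slopeNode_eq_rmul (hy _) (hy _) hα h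
      simp only at h1 h2
      -- Projective distinctness of the `y k` gives `k = k'`, hence `α = 1`. Then
      -- non-proportionality of the `u l` and `z ≠ 0` give `l = l'`, and injectivity of `z` does the
      -- rest.
      obtain rfl : k = k' := by
        by_contra hk
        exact hyp _ _ hk α hα h2
      rw [eq_one_of_rmul_eq_self (hne k) h2, mul_one] at h1
      obtain rfl : l = l' := by
        by_contra hl
        refine hup _ _ hl ((z (l, k) i)⁻¹ * z (l', k) i') ?_
        rw [mul_smul, ← h1, smul_smul, inv_mul_cancel₀ (hz0 _ _), one_smul]
      have hul : u l ≠ 0 := norm_ne_zero_iff.1 (by rw [hu]; exact one_ne_zero)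
      exact hik (by rw [hz _ (smul_left_injective ℝ hul h1)])
    · simp only [Sum.elim_inl, Sum.elim_inr, slopeNode, splitVec_symm_rmul] at h
      have h1 := congrArg norm (Prod.mk.inj ((splitVec K m).symm.injective h)).2
      rw [norm_rmul, norm_zero, zero_mul, norm_smul, hy, mul_one, norm_eq_zero] at h1
      exact (hpos _).ne' h1
    · simp only [Sum.elim_inl, Sum.elim_inr, slopeNode, splitVec_symm_rmul] at h
      have h1 := congrArg norm (Prod.mk.inj ((splitVec K m).symm.injective h)).2
      rw [norm_rmul, norm_zero, hα, mul_one, norm_smul, hy, mul_one, eq_comm, norm_eq_zero] at h1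
      exact (hpos _).ne' h1
    · rcases he with ⟨rfl, -⟩ | ⟨rfl, -⟩
      · exact i.elim0
      · exact hik (by rw [Subsingleton.elim i i'])
  · rintro (s | i)
    · have := hc s.1
      have := hw s.1 s.2
      simp only [Sum.elim_inl]
      positivity
    · rcases he with ⟨rfl, -⟩ | ⟨-, h⟩
      · exact i.elim0
      · exact h
  · intro φ hφ
    obtain ⟨D⟩ := exists_invariantDecomposition hφ
    have hfin : ∀ a, ∑ i, φ (slopeNode (z a i) (u a.1) (y a.2)) *
        ((c a * w a i * (1 + z a i ^ 2) ^ q : ℝ) : ℂ) =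
        c a * ∑ j ∈ Finset.range (p + 1), ((∑ i, w a i * z a i ^ j : ℝ) : ℂ) *
          D.comp j (u a.1) (y a.2) := by
      intro a
      have h1 : ∀ i, φ (slopeNode (z a i) (u a.1) (y a.2)) *
          ((c a * w a i * (1 + z a i ^ 2) ^ q : ℝ) : ℂ) =
          c a * ∑ j ∈ Finset.range (p + 1), ((w a i * z a i ^ j : ℝ) : ℂ) *
            D.comp j (u a.1) (y a.2) := by
        intro i
        have h2 := D.slopeNode_eq hφ hpq (z a i) (u a.1) (y a.2)
        rw [Complex.ofReal_mul, mul_left_comm, h2, Complex.ofReal_mul, mul_assoc, Finset.mul_sum]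
        congr 1
        refine Finset.sum_congr rfl fun j _ => ?_
        rw [Complex.ofReal_mul, mul_assoc]
      simp only [h1, ← Finset.mul_sum]
      rw [Finset.sum_comm]
      congr 1
      refine Finset.sum_congr rfl fun j _ => ?_
      rw [Complex.ofReal_sum, Finset.sum_mul]
    have hinf : ∑ _i : Fin e, φ ((splitVec K m).symm (1, 0)) * (B : ℂ) =
        ∑ a, (c a : ℂ) * (b a * D.comp p (u a.1) (y a.2)) := by
      have h1 : ∑ a, (c a : ℂ) * (b a * D.comp p (u a.1) (y a.2)) =
          φ ((splitVec K m).symm (1, 0)) * (B : ℂ) := by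
        rw [hB, Complex.ofReal_sum, Finset.mul_sum]
        refine Finset.sum_congr rfl fun a _ => ?_
        rw [← D.axis_eq (hu a.1) (y a.2)]
        push_cast
        ring
      rw [h1]
      rcases he with ⟨rfl, h⟩ | ⟨rfl, -⟩
      · have : B = 0 := by simp [hB, h]
        simp [this]
      · simp
    rw [hM φ hφ D, Fintype.sum_sum_type]
    simp only [Sum.elim_inl, Sum.elim_inr]
    rw [hinf, Fintype.sum_sigma]
    simp only [hfin, ← Finset.sum_add_distrib, ← mul_add]
    simp only [Finset.mul_sum]
    rw [Finset.sum_comm]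
    refine Finset.sum_congr rfl fun a _ => ?_
    have h1 : ∀ j ∈ Finset.range (p + 1), (M j : ℂ) * ((c a : ℂ) * D.comp j (u a.1) (y a.2)) =
        c a * (((∑ i, w a i * z a i ^ j : ℝ) : ℂ) * D.comp j (u a.1) (y a.2)) +
          if j = p then (c a : ℂ) * (b a * D.comp j (u a.1) (y a.2)) else 0 := by
      intro j hj
      rw [hzw a j (by have := Finset.mem_range.1 hj; omega), ← hpq, Complex.ofReal_add]
      split_ifs
      · ring
      · push_cast
        ring
    rw [Finset.sum_congr rfl h1, Finset.sum_add_distrib, Finset.sum_ite_eq',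
      if_pos (Finset.self_mem_range_succ p), mul_add, Finset.mul_sum]

variable [SMulCommClass ℝ K K]

/-- The recursive step over a real division algebra with a linear conjugation. -/
theorem exists_cubature_succ (hp : 4 ≤ p) (hpe : Even p) (hm : m ≠ 0)
    (hconj : ∃ c : K →ₗ[ℝ] K, ∀ u, ‖u‖ = 1 → c u = u⁻¹) (C : ProjectiveCubature K m p n) :
    (p % 4 = 2 → Nonempty (ProjectiveCubature K (m + 1) p (nu K p * (p / 2 + 1) * n))) ∧
    (p % 4 = 0 → Nonempty (ProjectiveCubature K (m + 1) p (nu K p * ((p / 2) * n + 1)))) := by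
  have : Nonempty (Fin m) := ⟨⟨0, Nat.pos_of_ne_zero hm⟩⟩
  have : Nontrivial (Vec K m) := inferInstance
  obtain ⟨u, lam, hu, hlam, hup, hdes⟩ := exists_design K (q := 2 * (p / 4)) (even_two_mul _)
    (by omega)
  obtain ⟨κ, hκ, hint⟩ := exists_integral_eq_sum_radialMoment K m p hpe hconj hu hdes C
  obtain ⟨q, hq⟩ : ∃ q, p = 2 * q := hpe.exists_two_nsmul _
  have hpd : PosDefUpTo (momentFunctional (radialMoment K (Vec K m) κ p)) q := by
    rw [hq]
    exact posDefUpTo_radialMoment hκ q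
  have hn := C.pos
  -- An empty design would integrate the constant `1` to `0`.
  have hν : 0 < nu K p := by
    rcases Nat.eq_zero_or_pos (nu K p) with h | h
    · have h1 := hdes 0 (Nat.zero_le _) Even.zero 1 one_mem_homPoly
      have : IsEmpty (Fin (minReal (finrank ℝ K) (2 * (p / 4)))) := by
        rw [show minReal (finrank ℝ K) (2 * (p / 4)) = 0 from h]
        infer_instance
      simp at h1
    · exact h
  have hq2 : p / 2 = q := by omega
  have hc : ∀ a : Fin (nu K p) × Fin n, 0 < lam a.1 * C.weight a.2 := fun a =>
    mul_pos (hlam _) (C.weight_pos _)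
  obtain ⟨z, w, hz, hz0, hw, hzw⟩ := exists_quadrature hpd
  rw [hq2]
  constructor
  · intro _
    have h := nonempty_of_quadratures (e := 0) hq hu hup C.norm_node C.node_distinct hc hint
      (fun _ => q + 1) (fun _ => z) (fun _ => w) (fun _ => 0) (fun _ => hz) (fun _ => hz0)
      (fun _ => hw) (fun _ j hj => by simpa using hzw j hj) (Or.inl ⟨rfl, fun _ => rfl⟩)
    have hcount : ∑ _a : Fin (nu K p) × Fin n, (q + 1) + 0 = nu K p * (q + 1) * n := by
      simp
      ring
    rwa [← hcount]
  · intro hp4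
    obtain ⟨z', w', b, hz', hz0', hw', hb, hzw'⟩ := exists_quadrature_infty hpd
      (by rw [Nat.even_iff]; omega) (by omega) (fun j hj => by
        rw [radialMoment, if_neg (Nat.not_even_iff_odd.2 hj)])
    -- Pairs in `T` receive the rule with `q + 1` finite nodes, which pads the count `ν n q + 1` up
    -- to `ν (q n + 1)`. As `ν - 1 < ν n`, some pair stays outside `T` and the axis node keeps a
    -- positive weight.
    obtain ⟨T, hT⟩ : ∃ T : Finset (Fin (nu K p) × Fin n), T.card = nu K p - 1 := by
      obtain ⟨T, -, hT⟩ := Finset.exists_subset_card_eq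
        (s := (Finset.univ : Finset (Fin (nu K p) × Fin n))) (n := nu K p - 1) (by
          simp only [Finset.card_univ, Fintype.card_prod, Fintype.card_fin]
          exact (Nat.sub_le _ _).trans (Nat.le_mul_of_pos_right _ hn))
      exact ⟨T, hT⟩
    classical
    have hquad : ∀ a : Fin (nu K p) × Fin n, ∃ (N : ℕ) (z w : Fin N → ℝ),
        N = (if a ∈ T then q + 1 else q) ∧ Function.Injective z ∧ (∀ i, z i ≠ 0) ∧
        (∀ i, 0 < w i) ∧ ∀ j ≤ 2 * q,
          radialMoment K (Vec K m) κ p j =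
            ∑ i, w i * z i ^ j + if j = 2 * q then (if a ∈ T then 0 else b) else 0 := by
      intro a
      by_cases ha : a ∈ T
      · simp only [ha, if_true, ite_self, add_zero]
        exact ⟨_, z, w, rfl, hz, hz0, hw, hzw⟩
      · simp only [ha, if_false]
        exact ⟨_, z', w', rfl, hz', hz0', hw', hzw'⟩
    choose N Z W hN hZ hZ0 hW hZW using hquad
    have hex : ∃ a, a ∉ T := by
      by_contra! h
      have h1 : T = Finset.univ := Finset.eq_univ_of_forall h
      have h2 := congrArg Finset.card h1
      rw [hT, Finset.card_univ, Fintype.card_prod, Fintype.card_fin, Fintype.card_fin] at h2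
      have := Nat.le_mul_of_pos_right (nu K p) hn
      omega
    have hB : 0 < ∑ a : Fin (nu K p) × Fin n,
        lam a.1 * C.weight a.2 * if a ∈ T then 0 else b := by
      obtain ⟨a, ha⟩ := hex
      refine Finset.sum_pos' (fun a _ => ?_) ⟨a, Finset.mem_univ a, ?_⟩
      · have := hc a
        split_ifs <;> positivity
      · rw [if_neg ha]
        exact mul_pos (hc a) hb
    have h := nonempty_of_quadratures (e := 1) hq hu hup C.norm_node C.node_distinct hc hint
      _ Z W _ hZ hZ0 hW hZW (Or.inr ⟨rfl, hB⟩)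
    have hcount : ∑ a, N a + 1 =
        nu K p * (q * n + 1) := by
      have h1 : ∀ a, N a = q + if a ∈ T then 1 else 0 := fun a => by
        rw [hN]
        split_ifs <;> rfl
      simp only [h1, Finset.sum_add_distrib, Finset.sum_ite_mem, Finset.univ_inter,
        Finset.sum_const, Finset.card_univ, Fintype.card_prod, Fintype.card_fin, smul_eq_mul,
        mul_one, hT]
      rw [add_assoc, Nat.sub_add_cancel hν]
      ring
    rwa [← hcount]

end Recursion

end ProjCubature

end

/-! ### The real, complex and quaternionic cases -/

open ProjCubature in
theorem theorem1p3 (m p n : ℕ) (hm : 2 ≤ m) (hp : 4 ≤ p) (hpe : Even p) :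
    (Nonempty (ProjectiveCubature ℝ (m - 1) p n) →
      (p % 4 = 2 → Nonempty (ProjectiveCubature ℝ m p (nu ℝ p * (p / 2 + 1) * n))) ∧
      (p % 4 = 0 → Nonempty (ProjectiveCubature ℝ m p (nu ℝ p * ((p / 2) * n + 1))))) ∧
    (Nonempty (ProjectiveCubature ℂ (m - 1) p n) →
      (p % 4 = 2 → Nonempty (ProjectiveCubature ℂ m p (nu ℂ p * (p / 2 + 1) * n))) ∧
      (p % 4 = 0 → Nonempty (ProjectiveCubature ℂ m p (nu ℂ p * ((p / 2) * n + 1))))) ∧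
    (Nonempty (ProjectiveCubature ℍ (m - 1) p n) →
      (p % 4 = 2 → Nonempty (ProjectiveCubature ℍ m p (nu ℍ p * (p / 2 + 1) * n))) ∧
      (p % 4 = 0 → Nonempty (ProjectiveCubature ℍ m p (nu ℍ p * ((p / 2) * n + 1))))) := by
  obtain ⟨k, rfl⟩ : ∃ k, m = k + 1 := ⟨m - 1, by omega⟩
  have hk : k ≠ 0 := by omega
  rw [Nat.add_sub_cancel]
  -- The real-linear map that agrees with inversion on the unit sphere is the identity for `ℝ`,
  -- where units are `±1`, and conjugation for `ℂ` and `ℍ`.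
  refine ⟨fun ⟨C⟩ => exists_cubature_succ hp hpe hk ⟨LinearMap.id, fun u hu => ?_⟩ C,
    fun ⟨C⟩ => exists_cubature_succ hp hpe hk
      ⟨Complex.conjLIE.toLinearEquiv.toLinearMap, fun u hu => ?_⟩ C,
    fun ⟨C⟩ => exists_cubature_succ hp hpe hk
      ⟨{ toFun := star, map_add' := star_add,
          map_smul' := fun t x => by ext <;> simp }, fun u hu => ?_⟩ C⟩
  · rcases eq_or_eq_neg_of_abs_eq hu with rfl | rfl <;> norm_num
  · change star u = u⁻¹
    rw [Complex.inv_def, Complex.normSq_eq_norm_sq, hu]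
    simp
  · change star u = u⁻¹
    rw [Quaternion.inv_def, Quaternion.normSq_eq_norm_mul_self, hu]
    simp
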